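/- **Theorem (unified Euler–Lagrange equation on time scales).** Let $\mathbb T\subset\mathbb R$ be a closed set with minimum $a$ and maximum $b$, and $I=[a,b]\cap\mathbb T=\mathbb T$. Let $\sigma(t)=\inf\{s\in\mathbb T:s>t\}$ and $\rho(t)=\sup\{s\in\mathbb T:s<t\}$, with $\sigma(b)=b$, $\rho(a)=a$. A point $t$ is right-dense if $\sigma(t)=t$, left-dense if $\rho(t)=t$, and right- or left-scattered otherwise. For a time scale $S$, $S^\kappa$ is $S$ without its maximum if that is left-scattered in $S$ (otherwise $S^\kappa=S$), $S_\kappa$ is $S$ without its minimum if that is right-scattered in $S$ (otherwise $S_\kappa=S$), and $I^{\kappa^2}_{\kappa^2}=(I^\kappa)^\kappa\cap(I_\kappa)_\kappa$. The number $f^\Delta(t)$ is the delta derivative of $f$ at $t$ if for every $\varepsilon>0$ one has $|f(\sigma(t))-f(s)-f^\Delta(t)(\sigma(t)-s)|\le\varepsilon|\sigma(t)-s|$ for all $s\in\mathbb T$ near $t$; the nabla derivative $f^\nabla(t)$ is defined in the same way with $\rho$ in place of $\sigma$. For $X\subset\mathbb R$, $f:X\to\mathbb R$, $t\in X$, $u\in\mathbb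 R$, the contingent epiderivative is $D_\uparrow f(t)(u)=\inf\{v\in\mathbb R:(u,v)\in T_{\mathrm{Epi}(f)}(t,f(t))\}\in[-\infty,+\infty]$ (with $\inf\emptyset=+\infty$), where $\mathrm{Epi}(f)=\{(t,\lambda)\in X\times\mathbb R:f(t)\le\lambda\}$ and $T_K(p)=\{v:\liminf_{h\to0^+}d(p+hv,K)/h=0\}$. For a function $f$ on a subset $S$ of $\mathbb T$, $\overline f$ is its extension to the convex hull of $S$ that is affine on every gap of $S$. Fix $u\neq0$ and $\alpha,\beta\in\mathbb R$. Put $(y\circ\xi_u)(t)=u\,y(\sigma(t))$ and $d_ut=u\,\Delta t$ if $u>0$, and $(y\circ\xi_u)(t)=u\,y(\rho(t))$ and $d_ut=u\,\nabla t$ if $u<0$. Here $\int_a^bf\,\Delta t=F(b)-F(a)$ for a continuous $F:\mathbb T\to\mathbb R$ with $F^\Delta=f$ on $\mathbb T\setminus\{b\}$, if such an $F$ exists, and $\int_a^bf\,\nabla t=F(b)-F(a)$ for a continuous $F$ with $F^\nabla=f$ on $\mathbb T\setminus\{a\}$, if such an $F$ exists. Let $I_u=I\setminus\{b\}$ if $u>0$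 and $I_u=I\setminus\{a\}$ if $u<0$. Let $L:I\times\mathbb R^2\to\mathbb R$, $(t,y,v)\mapsto L(t,y,v)$, have partial derivatives $\partial_2L,\partial_3L$ with respect to $y$ and $v$ that are continuous on $I\times\mathbb R^2$. Call $y:I\to\mathbb R$ admissible if $y(a)=\alpha$, $y(b)=\beta$, $y$ is regulated (finite right-sided limits at right-dense points, finite left-sided limits at left-dense points), $D_\uparrow\overline y(t)(u)$ is finite for every $t\in I_u$, and $y$ is rd-continuously delta differentiable if $u>0$, respectively ld-continuously nabla differentiable if $u<0$. (The former means that $y^\Delta$ exists on $I^\kappa$, is continuous there at right-dense points of $\mathbb T$, and has finite left-sided limits at left-dense points of $\mathbb T$; the latter that $y^\nabla$ exists on $I_\kappa$, is continuous there at left-dense points of $\mathbb T$, and has finite right-sided limits at right-dense points of $\mathbb T$.) Suppose that $y$ is a minimizer or a maximizer of $$\mathcal L[y]=\int_a^bL\bigl(t,(y\circ\xi_u)(t),D_\uparrow\overline y(t)(u)\bigr)\,d_ut$$ among all admissible functions for which this integral exists (it is required to exist for $y$). Let $g:I_u\to\mathbb R$, $g(t)=\partial_3L\bigl(t,(y\circ\xi_u)(t),D_\uparrow\overline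 y(t)(u)\bigr)$. Then $$D_\uparrow\overline g(t)(u)=u\cdot\partial_2L\bigl(t,(y\circ\xi_u)(t),D_\uparrow\overline y(t)(u)\bigr)$$ for all $t\in I^{\kappa^2}_{\kappa^2}$, with the exception of $t=\max I^\kappa$ if $u>0$ and of $t=\min I_\kappa$ if $u<0$. Moreover, if $u>0$, the delta Euler–Lagrange equation $$\bigl[\partial_3L(\cdot,u\,y^\sigma,u\,y^\Delta)\bigr]^\Delta(t)=\partial_2L\bigl(t,u\,y^\sigma(t),u\,y^\Delta(t)\bigr)$$ (with $y^\sigma=y\circ\sigma$, the function in brackets living on the time scale $I^\kappa$) holds for all $t\in I^{\kappa^2}_{\kappa^2}$, including $t=b$ if $b\in I^{\kappa^2}_{\kappa^2}$, but excluding $t=\max I^\kappa$ if $\max I^\kappa\ne b$. If $u<0$, the nabla Euler–Lagrange equation $$\bigl[\partial_3L(\cdot,u\,y^\rho,u\,y^\nabla)\bigr]^\nabla(t)=\partial_2L\bigl(t,u\,y^\rho(t),u\,y^\nabla(t)\bigr)$$ (with $y^\rho=y\circ\rho$, the function in brackets living on $I_\kappa$) holds for all $t\in I^{\kappa^2}_{\kappa^2}$,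 including $t=a$ if $a\in I^{\kappa^2}_{\kappa^2}$, but excluding $t=\min I_\kappa$ if $\min I_\kappa\ne a$. -/

import Mathlib

open Set Filter Topology

namespace TimeScale

/-! ### Jump operators, truncated time scales, derivatives -/

open Classical in
/-- Forward jump operator `σ(t) = inf {s ∈ T : s > t}`, with `σ(t) = t` if no such `s` exists. -/
noncomputable def sigma (T : Set ℝ) (t : ℝ) : ℝ :=
  if (T ∩ Ioi t).Nonempty then sInf (T ∩ Ioi t) else t

open Classical in
/-- Backward jump operator `ρ(t) = sup {s ∈ T : s < t}`, with `ρ(t) = t` if no such `s` exists. -/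
noncomputable def rho (T : Set ℝ) (t : ℝ) : ℝ :=
  if (T ∩ Iio t).Nonempty then sSup (T ∩ Iio t) else t

/-- `T^κ`: remove from `T` its maximum if that maximum exists and is left-scattered. -/
def upperKappa (T : Set ℝ) : Set ℝ := {t ∈ T | ¬ (IsGreatest T t ∧ rho T t < t)}

/-- `T_κ`: remove from `T` its minimum if that minimum exists and is right-scattered. -/
def lowerKappa (T : Set ℝ) : Set ℝ := {t ∈ T | ¬ (IsLeast T t ∧ t < sigma T t)}

/-- `d` is the delta derivative at `t` of the restriction of `f` to `T`. -/
def HasDeltaDeriv (T : Set ℝ) (f : ℝ → ℝ) (d t : ℝ) : Prop :=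
  ∀ ε > 0, ∃ δ > 0, ∀ s ∈ T, |s - t| < δ →
    |f (sigma T t) - f s - d * (sigma T t - s)| ≤ ε * |sigma T t - s|

/-- `d` is the nabla derivative at `t` of the restriction of `f` to `T`. -/
def HasNablaDeriv (T : Set ℝ) (f : ℝ → ℝ) (d t : ℝ) : Prop :=
  ∀ ε > 0, ∃ δ > 0, ∀ s ∈ T, |s - t| < δ →
    |f (rho T t) - f s - d * (rho T t - s)| ≤ ε * |rho T t - s|

/-- `f` is regulated on `T`: finite right-sided limits at right-dense points and finite left-sided
limits at left-dense points. -/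
def Regulated (T : Set ℝ) (f : ℝ → ℝ) : Prop :=
  ∀ t ∈ T, (sigma T t = t → ∃ l : ℝ, Tendsto f (𝓝[T ∩ Ioi t] t) (𝓝 l)) ∧
    (rho T t = t → ∃ l : ℝ, Tendsto f (𝓝[T ∩ Iio t] t) (𝓝 l))

/-- `f`, as a function on `S ⊆ T`, is rd-continuous (density of points refers to `T`). -/
def RdContinuousOn (T S : Set ℝ) (f : ℝ → ℝ) : Prop :=
  ∀ t ∈ S, (sigma T t = t → ContinuousWithinAt f S t) ∧
    (rho T t = t → ∃ l : ℝ, Tendsto f (𝓝[S ∩ Iio t] t) (𝓝 l))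

/-- `f`, as a function on `S ⊆ T`, is ld-continuous (density of points refers to `T`). -/
def LdContinuousOn (T S : Set ℝ) (f : ℝ → ℝ) : Prop :=
  ∀ t ∈ S, (rho T t = t → ContinuousWithinAt f S t) ∧
    (sigma T t = t → ∃ l : ℝ, Tendsto f (𝓝[S ∩ Ioi t] t) (𝓝 l))

/-- `f ∈ C¹_rd(T)`: delta differentiable on `T^κ` with rd-continuous delta derivative. -/
def RdC1 (T : Set ℝ) (f : ℝ → ℝ) : Prop :=
  ∃ f' : ℝ → ℝ, (∀ t ∈ upperKappa T, HasDeltaDeriv T f (f' t) t) ∧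
    RdContinuousOn T (upperKappa T) f'

/-- `f ∈ C¹_ld(T)`: nabla differentiable on `T_κ` with ld-continuous nabla derivative. -/
def LdC1 (T : Set ℝ) (f : ℝ → ℝ) : Prop :=
  ∃ f' : ℝ → ℝ, (∀ t ∈ lowerKappa T, HasNablaDeriv T f (f' t) t) ∧
    LdContinuousOn T (lowerKappa T) f'

/-! ### Integrals -/

/-- The delta integral of `f` from `a` to `b` exists and equals `K`: there is a delta antiderivative
`F`, and `K = F(b) - F(a)`. The integrand is only used on `T ∩ [a, b)`; at the end point `b`
(which lies in `T^κ` only if it is left-dense) `F` is required to be continuous. -/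
def HasDeltaIntegral (T : Set ℝ) (a b : ℝ) (f : ℝ → ℝ) (K : ℝ) : Prop :=
  ∃ F : ℝ → ℝ, ContinuousOn F (T ∩ Icc a b) ∧
    (∀ t ∈ T ∩ Ico a b, HasDeltaDeriv T F (f t) t) ∧ K = F b - F a

/-- The nabla integral of `f` from `a` to `b` exists and equals `K`; the integrand is only used on
`T ∩ (a, b]`. -/
def HasNablaIntegral (T : Set ℝ) (a b : ℝ) (f : ℝ → ℝ) (K : ℝ) : Prop :=
  ∃ F : ℝ → ℝ, ContinuousOn F (T ∩ Icc a b) ∧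
    (∀ t ∈ T ∩ Ioc a b, HasNablaDeriv T F (f t) t) ∧ K = F b - F a

/-- `∫_a^b f(t) d_u t` exists and equals `J`, where `d_u t = u Δt` for `u ≥ 0` and
`d_u t = u ∇t` for `u ≤ 0`. -/
def HasUnifiedIntegral (T : Set ℝ) (u a b : ℝ) (f : ℝ → ℝ) (J : ℝ) : Prop :=
  ∃ K : ℝ, (0 ≤ u → HasDeltaIntegral T a b f K) ∧ (u < 0 → HasNablaIntegral T a b f K) ∧ J = u * K

/-! ### Contingent epiderivatives -/

/-- The contingent cone `{v : liminf_{h → 0+} d(p + h v, K) / h = 0}`; the lower limit is taken in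
`[0, ∞]`. -/
def contingentCone (K : Set (ℝ × ℝ)) (p : ℝ × ℝ) : Set (ℝ × ℝ) :=
  {v | liminf (fun h : ℝ => Metric.infEDist (p + h • v) K / ENNReal.ofReal h) (𝓝[>] (0 : ℝ)) = 0}

/-- The graph of a set-valued map. -/
def graph (F : ℝ → Set ℝ) : Set (ℝ × ℝ) := {p | p.2 ∈ F p.1}

/-- The contingent derivative of a set-valued map at a point `p` of its graph: the set-valued map
whose graph is the contingent cone to the graph of `F` at `p`. -/
def contingentDeriv (F : ℝ → Set ℝ) (p : ℝ × ℝ) : ℝ → Set ℝ :=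
  fun u => {v | (u, v) ∈ contingentCone (graph F) p}

/-- The set-valued map `F_↑` of `f : X → ℝ` (empty outside `X`); its graph is the epigraph of `f`. -/
def epiMap (X : Set ℝ) (f : ℝ → ℝ) : ℝ → Set ℝ := fun t => {l | t ∈ X ∧ f t ≤ l}

/-- The contingent epiderivative at `t` in direction `u` of `f : X → ℝ`: the infimum in `[-∞, +∞]`
of the contingent derivative of `F_↑` at `(t, f t)` in direction `u`, with `inf ∅ = +∞`. -/
noncomputable def contingentEpideriv (X : Set ℝ) (f : ℝ → ℝ) (t u : ℝ) : EReal :=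
  sInf ((fun v : ℝ => (v : EReal)) '' contingentDeriv (epiMap X f) (t, f t) u)

open Classical in
/-- The piecewise-linear extension of `f : T → ℝ`: it agrees with `f` on `T` and is affine on each gap
`(s, σ(s))`. -/
noncomputable def extend (T : Set ℝ) (f : ℝ → ℝ) (t : ℝ) : ℝ :=
  if t ∈ T then f t
  else
    let s := sSup (T ∩ Iic t)
    f s + (f (sigma T s) - f s) / (sigma T s - s) * (t - s)

/-- The contingent epiderivative at `t` in direction `u` of the piecewise-linear extension of
`f : T → ℝ` to the convex hull of `T`. -/
noncomputable def epiderivExtend (T : Set ℝ) (f : ℝ → ℝ) (t u : ℝ) : EReal :=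
  contingentEpideriv (convexHull ℝ T) (extend T f) t u

/-- The points of `T` that have points of `T` on the side to which `u` points: `T` without its
maximum if `u > 0`, without its minimum if `u < 0`. At an omitted end point the epiderivative in
direction `u` of the extension of any function on `T` is `+∞`. -/
def directed (T : Set ℝ) (u : ℝ) : Set ℝ :=
  {t ∈ T | (0 < u → ∃ s ∈ T, t < s) ∧ (u < 0 → ∃ s ∈ T, s < t)}

/-! ### The variational problem -/

/-- `y ∘ ξ_u`: it is `u (y ∘ σ)` for `u ≥ 0` and `u (y ∘ ρ)` for `u ≤ 0`. -/
noncomputable def compXi (T : Set ℝ) (u : ℝ) (y : ℝ → ℝ) (t : ℝ) : ℝ :=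
  if 0 ≤ u then u * y (sigma T t) else u * y (rho T t)

/-- The partial derivative `∂₂L`. -/
noncomputable def partial2 (L : ℝ → ℝ → ℝ → ℝ) (t x v : ℝ) : ℝ := deriv (fun z => L t z v) x

/-- The partial derivative `∂₃L`. -/
noncomputable def partial3 (L : ℝ → ℝ → ℝ → ℝ) (t x v : ℝ) : ℝ := deriv (fun w => L t x w) v

/-- `L : T × ℝ² → ℝ` has partial derivatives in its second and third variables, and these are
continuous on `T × ℝ²`. -/
structure IsLagrangian (T : Set ℝ) (L : ℝ → ℝ → ℝ → ℝ) : Prop where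
  diff2 : ∀ t ∈ T, ∀ x v : ℝ, DifferentiableAt ℝ (fun z => L t z v) x
  diff3 : ∀ t ∈ T, ∀ x v : ℝ, DifferentiableAt ℝ (fun w => L t x w) v
  cont2 : ContinuousOn (fun p : ℝ × ℝ × ℝ => partial2 L p.1 p.2.1 p.2.2) (T ×ˢ univ)
  cont3 : ContinuousOn (fun p : ℝ × ℝ × ℝ => partial3 L p.1 p.2.1 p.2.2) (T ×ˢ univ)

/-- `t ↦ Φ(t, (y ∘ ξ_u)(t), D_↑ȳ(t)(u))`, meaningful where `D_↑ȳ(t)(u)` is finite. -/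
noncomputable def along (T : Set ℝ) (u : ℝ) (Φ : ℝ → ℝ → ℝ → ℝ) (y : ℝ → ℝ) (t : ℝ) : ℝ :=
  Φ t (compXi T u y t) (epiderivExtend T y t u).toReal

/-- Admissible functions: regulated, with finite `D_↑ȳ(t)(u)`, satisfying the boundary conditions,
and of class `C¹_rd` (if `u > 0`) or `C¹_ld` (if `u < 0`). -/
structure IsAdmissible (T : Set ℝ) (u a b α β : ℝ) (y : ℝ → ℝ) : Prop where
  regulated : Regulated T y
  finite : ∀ t ∈ directed T u, epiderivExtend T y t u ≠ ⊥ ∧ epiderivExtend T y t u ≠ ⊤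
  left : y a = α
  right : y b = β
  rdC1 : 0 < u → RdC1 T y
  ldC1 : u < 0 → LdC1 T y

/-- The cost `∫_a^b L(t, (y ∘ ξ_u)(t), D_↑ȳ(t)(u)) d_u t` of `y` exists and equals `J`. -/
def HasCost (T : Set ℝ) (u a b : ℝ) (L : ℝ → ℝ → ℝ → ℝ) (y : ℝ → ℝ) (J : ℝ) : Prop :=
  HasUnifiedIntegral T u a b (along T u L y) J

/-- `y` is a minimizer of the cost among the admissible functions whose cost exists. -/
def IsMinimizer (T : Set ℝ) (u a b α β : ℝ) (L : ℝ → ℝ → ℝ → ℝ) (y : ℝ → ℝ) : Prop :=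
  IsAdmissible T u a b α β y ∧ ∃ J, HasCost T u a b L y J ∧
    ∀ z J', IsAdmissible T u a b α β z → HasCost T u a b L z J' → J ≤ J'

/-- `y` is a maximizer of the cost among the admissible functions whose cost exists. -/
def IsMaximizer (T : Set ℝ) (u a b α β : ℝ) (L : ℝ → ℝ → ℝ → ℝ) (y : ℝ → ℝ) : Prop :=
  IsAdmissible T u a b α β y ∧ ∃ J, HasCost T u a b L y J ∧
    ∀ z J', IsAdmissible T u a b α β z → HasCost T u a b L z J' → J' ≤ J

end TimeScale

namespace TimeScale

/-! ### Jump operators -/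

/-! Let `u > 0`. At a point `t < b` of the time scale the right derivative of the piecewise-affine
extension is the delta derivative, and a function with right derivative `d` has contingent
epiderivative `u * d` in direction `u` (`HasDeltaDeriv.epiderivExtend_eq`, `contingentEpideriv_eq`).
Hence the cost is `u` times the delta integral of `L(t, u y^σ, u y^Δ)`, and an extremal of the
unified problem is an extremal of a delta problem.

The delta problem yields to the argument of du Bois-Reymond. An rd-continuous function has a delta
antiderivative, namely the Lebesgue primitive of its extension that is constant on gaps
(`hasDeltaDeriv_integral_step`). Write `A`, `B` for `∂₂L`, `∂₃L` along `y`; the first variation `∫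
(A η^σ + B η^Δ)` vanishes (`IsDeltaMinimizer.integral_eq_zero`). Let `P` be a primitive of `A` and
let `η^Δ = B - P - c`, with `c` chosen so that `η(b) = 0`. The product rule turns the first
variation into `∫ (B - P - c)² = 0`, so `B = P + c` on `T^κ` and `B` inherits the delta derivative
`A` of `P` (`IsDeltaMinimizer.exists_antideriv`). Applying the formula for epiderivatives once more,
now to `B` on `T` without `b`, gives the unified equation.

`L` itself need not be continuous in `t`. Only `L(t,x,v) - L(t,0,0)` is, and this suffices: the
integral along `y` exists by assumption, and the integrand of a variation differs from it by an
rd-continuous function.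

A sign `k = ±1` treats maximizers along with minimizers, and the reflection `t ↦ -t` carries the
nabla problem for `u < 0` to a delta problem. -/

theorem le_sigma (T : Set ℝ) (t : ℝ) : t ≤ sigma T t := by
  unfold sigma
  split_ifs with h
  · exact le_csInf h fun s hs => le_of_lt hs.2
  · exact le_rfl

theorem rho_le (T : Set ℝ) (t : ℝ) : rho T t ≤ t := by
  unfold rho
  split_ifs with h
  · exact csSup_le h fun s hs => le_of_lt hs.2
  · exact le_rfl

theorem sigma_le {T : Set ℝ} {s t : ℝ} (hs : s ∈ T) (h : t < s) : sigma T t ≤ s := by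
  have hne : (T ∩ Ioi t).Nonempty := ⟨s, hs, h⟩
  rw [sigma, if_pos hne]
  exact csInf_le ⟨t, fun x hx => le_of_lt hx.2⟩ ⟨hs, h⟩

theorem le_rho {T : Set ℝ} {s t : ℝ} (hs : s ∈ T) (h : s < t) : s ≤ rho T t := by
  have hne : (T ∩ Iio t).Nonempty := ⟨s, hs, h⟩
  rw [rho, if_pos hne]
  exact le_csSup ⟨t, fun x hx => le_of_lt hx.2⟩ ⟨hs, h⟩

theorem sigma_mem {T : Set ℝ} (hT : IsClosed T) {t : ℝ} (ht : t ∈ T) : sigma T t ∈ T := by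
  unfold sigma
  split_ifs with h
  · have := csInf_mem_closure h ⟨t, fun x hx => le_of_lt hx.2⟩
    exact hT.closure_subset_iff.2 inter_subset_left this
  · exact ht

theorem sigma_of_isGreatest {T : Set ℝ} {b : ℝ} (hb : IsGreatest T b) : sigma T b = b := by
  rw [sigma, if_neg]
  rintro ⟨s, hs, h⟩
  exact absurd (hb.2 hs) (not_le.2 h)

theorem exists_mem_Ioo_of_sigma_eq {T : Set ℝ} {t c : ℝ} (h : sigma T t = t) (hc : c ∈ T)
    (htc : t < c) {r : ℝ} (hr : t < r) : ∃ s ∈ T, t < s ∧ s < r := by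
  by_contra! H
  have hne : (T ∩ Ioi t).Nonempty := ⟨c, hc, htc⟩
  rw [sigma, if_pos hne] at h
  have : r ≤ sInf (T ∩ Ioi t) := le_csInf hne fun s hs => H s hs.1 hs.2
  linarith

theorem exists_mem_Ioo_of_rho_eq {T : Set ℝ} {t c : ℝ} (h : rho T t = t) (hc : c ∈ T)
    (htc : c < t) {r : ℝ} (hr : r < t) : ∃ s ∈ T, r < s ∧ s < t := by
  by_contra! H
  have hne : (T ∩ Iio t).Nonempty := ⟨c, hc, htc⟩
  rw [rho, if_pos hne] at h
  have : sSup (T ∩ Iio t) ≤ r := csSup_le hne fun s hs => by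
    by_contra! h'
    exact absurd (H s hs.1 h') (not_le.2 hs.2)
  linarith

theorem upperKappa_subset (T : Set ℝ) : upperKappa T ⊆ T := fun _ h => h.1

theorem lowerKappa_subset (T : Set ℝ) : lowerKappa T ⊆ T := fun _ h => h.1

theorem mem_upperKappa_of_lt {T : Set ℝ} {s t : ℝ} (ht : t ∈ T) (hs : s ∈ T) (h : t < s) :
    t ∈ upperKappa T := ⟨ht, fun H => absurd (H.1.2 hs) (not_le.2 h)⟩

/-- A point `r` of `T` slightly to the right of `t` caps `sigma T s` for all `s < r`. Together with
`tendsto_sigma_left` this makes `f ∘ σ` rd-continuous for continuous `f`. -/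
theorem tendsto_sigma_of_sigma_eq {T : Set ℝ} (hT : IsClosed T) {t : ℝ}
    (h : sigma T t = t) : Tendsto (sigma T) (𝓝[T] t) (𝓝[T] t) := by
  refine tendsto_nhdsWithin_iff.2
    ⟨?_, eventually_nhdsWithin_of_forall fun s hs => sigma_mem hT hs⟩
  rw [Metric.tendsto_nhds]
  intro ε hε
  have key : ∃ r > t, ∀ s ∈ T, s < r → sigma T s < t + ε := by
    by_cases hc : ∃ c ∈ T, t < c
    · obtain ⟨c, hc, htc⟩ := hc
      obtain ⟨r, hr, h1, h2⟩ := exists_mem_Ioo_of_sigma_eq h hc htc (lt_add_of_pos_right t hε)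
      exact ⟨r, h1, fun s _ hs => (sigma_le hr hs).trans_lt h2⟩
    · push Not at hc
      refine ⟨t + 1, by linarith, fun s hs _ => ?_⟩
      have := hc _ (sigma_mem hT hs)
      linarith
  obtain ⟨r, hr, H⟩ := key
  have h1 : ∀ᶠ s in 𝓝[T] t, s < r := nhdsWithin_le_nhds (Iio_mem_nhds hr)
  have h2 : ∀ᶠ s in 𝓝[T] t, t - ε < s := nhdsWithin_le_nhds (Ioi_mem_nhds (by linarith))
  filter_upwards [h1, h2, self_mem_nhdsWithin] with s hs1 hs2 hs
  rw [Real.dist_eq, abs_lt]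
  have := le_sigma T s
  have := H s hs hs1
  constructor <;> linarith

theorem tendsto_sigma_left {T : Set ℝ} (hT : IsClosed T) {t : ℝ} (ht : t ∈ T) :
    Tendsto (sigma T) (𝓝[T ∩ Iio t] t) (𝓝[T] t) := by
  refine tendsto_nhdsWithin_iff.2
    ⟨?_, eventually_nhdsWithin_of_forall fun s hs => sigma_mem hT hs.1⟩
  refine tendsto_of_tendsto_of_tendsto_of_le_of_le' (nhdsWithin_le_nhds : 𝓝[T ∩ Iio t] t ≤ 𝓝 t)
    tendsto_const_nhds ?_ ?_
  · exact Eventually.of_forall fun s => le_sigma T s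
  · exact eventually_nhdsWithin_of_forall fun s hs => sigma_le ht hs.2

/-! ### Delta derivatives -/

theorem hasDeltaDeriv_iff_isLittleO {T : Set ℝ} {f : ℝ → ℝ} {d t : ℝ} :
    HasDeltaDeriv T f d t ↔
      (fun s => f (sigma T t) - f s - d * (sigma T t - s)) =o[𝓝[T] t] fun s => sigma T t - s := by
  rw [Asymptotics.isLittleO_iff]
  simp only [HasDeltaDeriv, Real.norm_eq_abs]
  refine forall₂_congr fun ε hε => ?_
  rw [eventually_nhdsWithin_iff, Metric.eventually_nhds_iff]
  simp only [Real.dist_eq]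
  exact exists_congr fun δ => and_congr_right fun _ =>
    ⟨fun h y hy hyT => h y hyT hy, fun h y hyT hy => h hy hyT⟩

/-- The definition admits `s = t` for every `ε`, so the error there is exactly zero: across a gap
the derivative is a difference quotient. -/
theorem HasDeltaDeriv.sigma_eq {T : Set ℝ} {f : ℝ → ℝ} {d t : ℝ} (h : HasDeltaDeriv T f d t)
    (ht : t ∈ T) : f (sigma T t) = f t + d * (sigma T t - t) := by
  have : ∀ ε > 0, |f (sigma T t) - f t - d * (sigma T t - t)| ≤ ε * |sigma T t - t| := by
    intro ε hε
    obtain ⟨δ, hδ, H⟩ := h ε hε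
    exact H t ht (by simpa using hδ)
  have h0 : |f (sigma T t) - f t - d * (sigma T t - t)| ≤ 0 := by
    refine le_of_forall_pos_le_add fun ε hε => ?_
    have h1 := abs_nonneg (sigma T t - t)
    refine (this (ε / (|sigma T t - t| + 1)) (by positivity)).trans ?_
    rw [div_mul_eq_mul_div, div_le_iff₀ (by positivity)]
    nlinarith
  have := abs_nonpos_iff.1 h0
  linarith

theorem HasDeltaDeriv.continuousWithinAt {T : Set ℝ} {f : ℝ → ℝ} {d t : ℝ}
    (h : HasDeltaDeriv T f d t) (ht : t ∈ T) : ContinuousWithinAt f T t := by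
  have hs : Tendsto (fun s => sigma T t - s) (𝓝[T] t) (𝓝 (sigma T t - t)) :=
    (tendsto_const_nhds.sub tendsto_id).mono_left nhdsWithin_le_nhds
  have h0 : Tendsto (fun s => f (sigma T t) - f s - d * (sigma T t - s)) (𝓝[T] t) (𝓝 0) :=
    (Asymptotics.isLittleO_one_iff ℝ).1
      ((hasDeltaDeriv_iff_isLittleO.1 h).trans_isBigO (hs.isBigO_one ℝ))
  have h1 := ((tendsto_const_nhds (x := f (sigma T t))).sub (hs.const_mul d)).sub h0
  have h2 : f (sigma T t) - d * (sigma T t - t) - 0 = f t := by rw [h.sigma_eq ht]; ring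
  rw [h2] at h1
  exact h1.congr fun s => by ring

theorem HasDeltaDeriv.add {T : Set ℝ} {f g : ℝ → ℝ} {d e t : ℝ} (hf : HasDeltaDeriv T f d t)
    (hg : HasDeltaDeriv T g e t) : HasDeltaDeriv T (fun s => f s + g s) (d + e) t := by
  rw [hasDeltaDeriv_iff_isLittleO] at *
  exact (hf.add hg).congr_left fun s => by ring

theorem HasDeltaDeriv.const_mul {T : Set ℝ} {f : ℝ → ℝ} {d t : ℝ} (c : ℝ)
    (hf : HasDeltaDeriv T f d t) : HasDeltaDeriv T (fun s => c * f s) (c * d) t := by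
  rw [hasDeltaDeriv_iff_isLittleO] at *
  exact (hf.const_mul_left c).congr_left fun s => by ring

theorem HasDeltaDeriv.sub {T : Set ℝ} {f g : ℝ → ℝ} {d e t : ℝ} (hf : HasDeltaDeriv T f d t)
    (hg : HasDeltaDeriv T g e t) : HasDeltaDeriv T (fun s => f s - g s) (d - e) t := by
  rw [hasDeltaDeriv_iff_isLittleO] at *
  exact (hf.sub hg).congr_left fun s => by ring

theorem hasDeltaDeriv_const (T : Set ℝ) (c t : ℝ) : HasDeltaDeriv T (fun _ => c) 0 t := by
  intro ε hε
  refine ⟨1, one_pos, fun s _ _ => ?_⟩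
  simp only [sub_self, zero_mul, abs_zero]
  positivity

theorem HasDeltaDeriv.mul {T : Set ℝ} {f g : ℝ → ℝ} {d e t : ℝ} (ht : t ∈ T)
    (hf : HasDeltaDeriv T f d t) (hg : HasDeltaDeriv T g e t) :
    HasDeltaDeriv T (fun s => f s * g s) (f (sigma T t) * e + d * g t) t := by
  have hc := hg.continuousWithinAt ht
  rw [hasDeltaDeriv_iff_isLittleO] at *
  have h1 := hg.const_mul_left (f (sigma T t))
  have h2 := (hc.isBigO_one ℝ).mul_isLittleO hf
  -- The error of the product is `f (σ t)` times that of `g`, plus `g s` times that of `f`, plus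
  -- this remainder from replacing `g s` by `g t`, which is small because `g` is continuous at `t`.
  have h3 : (fun s => (g s - g t) * (d * (sigma T t - s))) =o[𝓝[T] t]
      fun s => 1 * (sigma T t - s) := by
    refine Asymptotics.IsLittleO.mul_isBigO ?_ (Asymptotics.isBigO_const_mul_self _ _ _)
    rw [Asymptotics.isLittleO_one_iff]
    simpa using hc.sub_const (g t)
  simp only [one_mul] at h2 h3
  exact ((h1.add h2).add h3).congr_left fun s => by ring

theorem HasDeltaDeriv.congr {T : Set ℝ} {f g : ℝ → ℝ} {d t : ℝ} (hT : sigma T t ∈ T)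
    (hf : HasDeltaDeriv T f d t) (h : ∀ s ∈ T, g s = f s) : HasDeltaDeriv T g d t := by
  intro ε hε
  obtain ⟨δ, hδ, H⟩ := hf ε hε
  refine ⟨δ, hδ, fun s hs hst => ?_⟩
  rw [h _ hT, h s hs]
  exact H s hs hst

theorem HasDeltaDeriv.mono {S T : Set ℝ} {f : ℝ → ℝ} {d t : ℝ}
    (hf : HasDeltaDeriv T f d t) (hS : S ⊆ T) (h : sigma S t = sigma T t) :
    HasDeltaDeriv S f d t := by
  intro ε hε
  obtain ⟨δ, hδ, H⟩ := hf ε hε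
  exact ⟨δ, hδ, fun s hs hst => by rw [h]; exact H s (hS hs) hst⟩

/-! ### Uniqueness of delta derivatives and of antiderivatives -/

theorem HasDeltaDeriv.unique {T : Set ℝ} {f : ℝ → ℝ} {d e t : ℝ} (hf : HasDeltaDeriv T f d t)
    (hg : HasDeltaDeriv T f e t) (h : ∃ᶠ s in 𝓝[T] t, s ≠ sigma T t) : d = e := by
  have hd := (hg.sub hf)
  rw [hasDeltaDeriv_iff_isLittleO] at hd
  have h1 : (fun s => (e - d) * (sigma T t - s)) =o[𝓝[T] t] fun s => sigma T t - s :=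
    hd.neg_left.congr_left fun s => by ring
  by_contra hne
  have hne' : e - d ≠ 0 := sub_ne_zero.2 (Ne.symm hne)
  have h2 := h1.const_mul_left (e - d)⁻¹
  have h3 : (fun s => sigma T t - s) =o[𝓝[T] t] fun s => sigma T t - s :=
    h2.congr_left fun s => by rw [← mul_assoc, inv_mul_cancel₀ hne', one_mul]
  have h4 := h3.def (c := 1 / 2) (by norm_num)
  obtain ⟨s, hs, hs'⟩ := (h.and_eventually h4).exists
  have : 0 < ‖sigma T t - s‖ := norm_pos_iff.2 (sub_ne_zero.2 (Ne.symm hs))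
  linarith

/-- At a right-scattered `t` the point `t` itself serves. At a right-dense `t` other points must
accumulate; this fails only for a left-scattered maximum, which `T^κ` omits, or for a one-point time
scale, which `c` rules out. -/
theorem frequently_ne_sigma {T : Set ℝ} {t c : ℝ} (ht : t ∈ upperKappa T) (hc : c ∈ T)
    (hct : c ≠ t) : ∃ᶠ s in 𝓝[T] t, s ≠ sigma T t := by
  by_cases hd : sigma T t = t
  · rw [hd, (nhdsWithin_hasBasis Metric.nhds_basis_ball T).frequently_iff]
    intro r hr
    rcases hct.lt_or_gt with hlt | hgt
    · by_cases hl : rho T t = t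
      · obtain ⟨s, hs, h1, h2⟩ := exists_mem_Ioo_of_rho_eq hl hc hlt (sub_lt_self t hr)
        refine ⟨s, ⟨?_, hs⟩, h2.ne⟩
        rw [Metric.mem_ball, Real.dist_eq, abs_lt]
        constructor <;> linarith
      · have hl' : rho T t < t := lt_of_le_of_ne (rho_le T t) hl
        have : ∃ c ∈ T, t < c := by
          by_contra! H
          exact ht.2 ⟨⟨ht.1, H⟩, hl'⟩
        obtain ⟨c, hc, htc⟩ := this
        obtain ⟨s, hs, h1, h2⟩ := exists_mem_Ioo_of_sigma_eq hd hc htc (lt_add_of_pos_right t hr)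
        refine ⟨s, ⟨?_, hs⟩, h1.ne'⟩
        rw [Metric.mem_ball, Real.dist_eq, abs_lt]
        constructor <;> linarith
    · obtain ⟨s, hs, h1, h2⟩ := exists_mem_Ioo_of_sigma_eq hd hc hgt (lt_add_of_pos_right t hr)
      refine ⟨s, ⟨?_, hs⟩, h1.ne'⟩
      rw [Metric.mem_ball, Real.dist_eq, abs_lt]
      constructor <;> linarith
  · rw [(nhdsWithin_hasBasis Metric.nhds_basis_ball T).frequently_iff]
    exact fun r hr => ⟨t, ⟨Metric.mem_ball_self hr, ht.1⟩, Ne.symm hd⟩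

/-- A function on a compact time scale with vanishing delta derivative is constant. -/
theorem eq_of_hasDeltaDeriv_zero {T : Set ℝ} (hT : IsClosed T) {a b : ℝ} (ha : IsLeast T a)
    (hb : IsGreatest T b) {f : ℝ → ℝ} (hc : ContinuousOn f T)
    (hf : ∀ t ∈ T ∩ Ico a b, HasDeltaDeriv T f 0 t) : f b = f a := by
  have main : ∀ ε > 0, |f b - f a| ≤ ε * (b - a) := by
    intro ε hε
    -- Continuous induction: `S` is closed, so it contains its supremum `m`. If `m < b`, the
    -- vanishing derivative puts a larger point into `S`, either `σ m` or a nearby point on the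
    -- right.
    set S : Set ℝ := {t ∈ T | |f t - f a| ≤ ε * (t - a)} with hS
    have hSc : IsClosed S := by
      have : S = {t ∈ T | |f t - f a| ≤ ε * (t - a)} := rfl
      rw [this]
      exact hT.isClosed_le (hc.sub continuousOn_const).abs (by fun_prop)
    have haS : a ∈ S := ⟨ha.1, by simp⟩
    have hbdd : BddAbove S := ⟨b, fun t ht => hb.2 ht.1⟩
    have hmS : sSup S ∈ S := hSc.csSup_mem ⟨a, haS⟩ hbdd
    set m := sSup S
    have hmax : ∀ t ∈ S, t ≤ m := fun t ht => le_csSup hbdd ht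
    have ham : a ≤ m := hmax a haS
    rcases (hb.2 hmS.1).eq_or_lt with hmb | hmb
    · rw [← hmb]; exact hmS.2
    · exfalso
      have hd := hf m ⟨hmS.1, ham, hmb⟩
      by_cases hr : sigma T m = m
      · obtain ⟨δ, hδ, H⟩ := hd ε hε
        obtain ⟨s, hs, h1, h2⟩ :=
          exists_mem_Ioo_of_sigma_eq hr hb.1 hmb (lt_add_of_pos_right m hδ)
        have h3 := H s hs (by rw [abs_lt]; constructor <;> linarith)
        rw [hr, zero_mul, sub_zero, abs_sub_comm, abs_sub_comm m s,
          abs_of_pos (sub_pos.2 h1)] at h3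
        have h4 : s ∈ S := ⟨hs, by
          have := abs_sub_le (f s) (f m) (f a)
          have := hmS.2
          linarith⟩
        exact absurd (hmax s h4) (not_le.2 h1)
      · have h1 : m < sigma T m := lt_of_le_of_ne (le_sigma T m) (Ne.symm hr)
        have h2 := hd.sigma_eq hmS.1
        have h4 : sigma T m ∈ S := ⟨sigma_mem hT hmS.1, by
          rw [h2, zero_mul, add_zero]
          refine hmS.2.trans (by gcongr)⟩
        exact absurd (hmax _ h4) (not_le.2 h1)
  have hab : a ≤ b := ha.2 hb.1
  have h0 : |f b - f a| ≤ 0 := by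
    refine le_of_forall_pos_le_add fun ε hε => ?_
    refine (main (ε / (b - a + 1)) (div_pos hε (by linarith))).trans ?_
    rw [div_mul_eq_mul_div, div_le_iff₀ (by linarith)]
    nlinarith
  linarith [abs_nonpos_iff.1 h0]

/-! ### Rd-continuous functions -/

theorem mem_upperKappa_of_rho_eq {T : Set ℝ} {t : ℝ} (ht : t ∈ T) (h : rho T t = t) :
    t ∈ upperKappa T := ⟨ht, fun H => absurd H.2 (by rw [h]; exact lt_irrefl t)⟩

theorem upperKappa_inter_Iio {T : Set ℝ} {t : ℝ} (ht : t ∈ T) :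
    upperKappa T ∩ Iio t = T ∩ Iio t := by
  ext s
  exact ⟨fun h => ⟨h.1.1, h.2⟩, fun h => ⟨mem_upperKappa_of_lt h.1 ht h.2, h.2⟩⟩

theorem RdContinuousOn.comp₂ {T S : Set ℝ} (hS : S ⊆ T) {f g : ℝ → ℝ}
    (hf : RdContinuousOn T S f) (hg : RdContinuousOn T S g) {Φ : ℝ × ℝ × ℝ → ℝ}
    (hΦ : ContinuousOn Φ (T ×ˢ univ)) : RdContinuousOn T S fun t => Φ (t, f t, g t) := by
  intro t ht
  constructor
  · intro h
    refine ContinuousWithinAt.comp (t := T ×ˢ univ) (hΦ _ ⟨hS ht, mem_univ _⟩) ?_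
      fun s hs => ⟨hS hs, mem_univ _⟩
    exact continuousWithinAt_id.prodMk (((hf t ht).1 h).prodMk ((hg t ht).1 h))
  · intro h
    obtain ⟨l, hl⟩ := (hf t ht).2 h
    obtain ⟨m, hm⟩ := (hg t ht).2 h
    refine ⟨Φ (t, l, m), (hΦ (t, l, m) ⟨hS ht, mem_univ _⟩).tendsto.comp
      (tendsto_nhdsWithin_iff.2 ⟨?_, eventually_nhdsWithin_of_forall
        fun s hs => ⟨hS hs.1, mem_univ _⟩⟩)⟩
    exact (tendsto_id.mono_left nhdsWithin_le_nhds).prodMk_nhds (hl.prodMk_nhds hm)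

theorem rdContinuousOn_of_continuousOn {T S : Set ℝ} (hS : S ⊆ T) {f : ℝ → ℝ}
    (hf : ContinuousOn f T) : RdContinuousOn T S f := fun t ht =>
  ⟨fun _ => (hf t (hS ht)).mono hS, fun _ => ⟨f t, (hf t (hS ht)).mono_left
    (nhdsWithin_mono t (inter_subset_left.trans hS))⟩⟩

theorem rdContinuousOn_comp_sigma {T S : Set ℝ} (hT : IsClosed T) (hS : S ⊆ T) {f : ℝ → ℝ}
    (hf : ContinuousOn f T) : RdContinuousOn T S fun t => f (sigma T t) := fun t ht =>
  ⟨fun h => by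
    have h1 := (hf t (hS ht)).tendsto.comp (tendsto_sigma_of_sigma_eq hT h)
    rw [ContinuousWithinAt, h]
    exact h1.mono_left (nhdsWithin_mono t hS),
   fun _ => ⟨f t, ((hf t (hS ht)).tendsto.comp (tendsto_sigma_left hT (hS ht))).mono_left
    (nhdsWithin_mono t (inter_subset_inter_left _ hS))⟩⟩

theorem RdContinuousOn.add {T S : Set ℝ} (hS : S ⊆ T) {f g : ℝ → ℝ} (hf : RdContinuousOn T S f)
    (hg : RdContinuousOn T S g) : RdContinuousOn T S fun t => f t + g t :=
  hf.comp₂ hS hg (Φ := fun p => p.2.1 + p.2.2) (by fun_prop)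

theorem RdContinuousOn.sub {T S : Set ℝ} (hS : S ⊆ T) {f g : ℝ → ℝ} (hf : RdContinuousOn T S f)
    (hg : RdContinuousOn T S g) : RdContinuousOn T S fun t => f t - g t :=
  hf.comp₂ hS hg (Φ := fun p => p.2.1 - p.2.2) (by fun_prop)

theorem RdContinuousOn.mul {T S : Set ℝ} (hS : S ⊆ T) {f g : ℝ → ℝ} (hf : RdContinuousOn T S f)
    (hg : RdContinuousOn T S g) : RdContinuousOn T S fun t => f t * g t :=
  hf.comp₂ hS hg (Φ := fun p => p.2.1 * p.2.2) (by fun_prop)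

/-- Local boundedness plus compactness. At a dense side a one-sided limit gives the bound, and a
scattered side has no nearby points. A maximum missing from `T^κ` does no harm, since it is isolated
in `T`. -/
theorem RdContinuousOn.exists_bound {T : Set ℝ} (hT : IsCompact T) {f : ℝ → ℝ}
    (hf : RdContinuousOn T (upperKappa T) f) : ∃ R, ∀ t ∈ T, |f t| ≤ R := by
  refine hT.induction_on (p := fun s => ∃ R, ∀ t ∈ s, |f t| ≤ R) ⟨0, by simp⟩
    (fun s t hst ⟨R, h⟩ => ⟨R, fun x hx => h x (hst hx)⟩)
    (fun s t ⟨R, h⟩ ⟨R', h'⟩ => ⟨max R R', fun x hx => hx.elim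
      (fun hx => (h x hx).trans (le_max_left _ _)) (fun hx => (h' x hx).trans (le_max_right _ _))⟩)
    fun t ht => ?_
  have bdd : ∀ {F : Filter ℝ} {l : ℝ}, Tendsto f F (𝓝 l) → ∃ R, ∀ᶠ s in F, |f s| ≤ R := by
    intro F l h
    exact ⟨|l| + 1, (h.abs.eventually (Iic_mem_nhds (lt_add_one |l|)))⟩
  have hL : ∃ R, ∀ᶠ s in 𝓝[T ∩ Iio t] t, |f s| ≤ R := by
    by_cases h : rho T t = t
    · obtain ⟨l, hl⟩ := (hf t (mem_upperKappa_of_rho_eq ht h)).2 h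
      rw [upperKappa_inter_Iio ht] at hl
      exact bdd hl
    · refine ⟨0, ?_⟩
      have h1 : ∀ᶠ s in 𝓝[T ∩ Iio t] t, rho T t < s :=
        nhdsWithin_le_nhds (Ioi_mem_nhds (lt_of_le_of_ne (rho_le T t) h))
      filter_upwards [h1, self_mem_nhdsWithin] with s hs hs'
      exact absurd (le_rho hs'.1 hs'.2) (not_le.2 hs)
  have hR : ∃ R, ∀ᶠ s in 𝓝[T ∩ Ioi t] t, |f s| ≤ R := by
    by_cases h : sigma T t = t
    · by_cases hc : ∃ c ∈ T, t < c
      · obtain ⟨c, hc, htc⟩ := hc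
        obtain ⟨R, H⟩ := bdd ((hf t (mem_upperKappa_of_lt ht hc htc)).1 h)
        refine ⟨R, ?_⟩
        rw [eventually_nhdsWithin_iff] at H ⊢
        filter_upwards [H, Iio_mem_nhds htc] with s hs hsc hsT
        exact hs (mem_upperKappa_of_lt hsT.1 hc hsc)
      · push Not at hc
        exact ⟨0, eventually_nhdsWithin_of_forall fun s hs => absurd (hc s hs.1) (not_le.2 hs.2)⟩
    · refine ⟨0, ?_⟩
      have h1 : ∀ᶠ s in 𝓝[T ∩ Ioi t] t, s < sigma T t :=
        nhdsWithin_le_nhds (Iio_mem_nhds (lt_of_le_of_ne (le_sigma T t) (Ne.symm h)))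
      filter_upwards [h1, self_mem_nhdsWithin] with s hs hs'
      exact absurd (sigma_le hs'.1 hs'.2) (not_le.2 hs)
  obtain ⟨R, hR⟩ := hR
  obtain ⟨R', hL⟩ := hL
  rw [eventually_nhdsWithin_iff] at hL hR
  refine ⟨{s | |f s| ≤ max (max R R') |f t|}, ?_, _, fun s hs => hs⟩
  refine mem_nhdsWithin_iff_eventually.2 ?_
  filter_upwards [hL, hR] with s h1 h2 hs
  rcases lt_trichotomy s t with h | h | h
  · exact (h1 ⟨hs, h⟩).trans ((le_max_right _ _).trans (le_max_left _ _))
  · rw [h]; exact le_max_right _ _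
  · exact (h2 ⟨hs, h⟩).trans ((le_max_left _ _).trans (le_max_left _ _))

/-! ### Integration of rd-continuous functions -/

/-- The largest point of `T` that does not exceed `x`. -/
noncomputable def floor (T : Set ℝ) (x : ℝ) : ℝ := sSup (T ∩ Iic x)

theorem floor_le {T : Set ℝ} {c x : ℝ} (hc : c ∈ T) (h : c ≤ x) : floor T x ≤ x :=
  csSup_le ⟨c, hc, h⟩ fun _ hs => hs.2

theorem le_floor {T : Set ℝ} {s x : ℝ} (hs : s ∈ T) (h : s ≤ x) : s ≤ floor T x :=
  le_csSup ⟨x, fun _ hs => hs.2⟩ ⟨hs, h⟩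

theorem floor_mem {T : Set ℝ} (hT : IsClosed T) {c x : ℝ} (hc : c ∈ T) (h : c ≤ x) :
    floor T x ∈ T :=
  ((hT.inter isClosed_Iic).csSup_mem ⟨c, hc, h⟩ ⟨x, fun _ hs => hs.2⟩).1

theorem floor_of_mem {T : Set ℝ} {t : ℝ} (ht : t ∈ T) : floor T t = t :=
  le_antisymm (floor_le ht le_rfl) (le_floor ht le_rfl)

theorem floor_eq_of_lt_sigma {T : Set ℝ} (hT : IsClosed T) {t x : ℝ} (ht : t ∈ T) (h : t ≤ x)
    (hx : x < sigma T t) : floor T x = t := by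
  refine le_antisymm ?_ (le_floor ht h)
  by_contra! hlt
  have := sigma_le (floor_mem hT ht h) hlt
  linarith [floor_le ht h]

/-- The function that, on the part of the line to the right of `t ∈ T` and to the left of the next
point of `T`, takes the value `f t`. -/
noncomputable def step (T : Set ℝ) (a : ℝ) (f : ℝ → ℝ) (x : ℝ) : ℝ := f (floor T (max a x))

theorem step_of_mem {T : Set ℝ} {a t : ℝ} (ha : IsLeast T a) (ht : t ∈ T) (f : ℝ → ℝ) :
    step T a f t = f t := by
  rw [step, max_eq_right (ha.2 ht), floor_of_mem ht]

/-- The function is a pointwise limit of its values at the first multiple of `1 / (n + 1)` strictly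
to the right of `x`. Each approximant depends only on an integer part, hence is measurable. -/
theorem measurable_of_continuousWithinAt_Ici {f : ℝ → ℝ}
    (h : ∀ x, ContinuousWithinAt f (Ici x) x) : Measurable f := by
  refine measurable_of_tendsto_metrizable
    (f := fun (n : ℕ) x => f ((⌊((n : ℝ) + 1) * x⌋ + 1) / ((n : ℝ) + 1))) (fun n => ?_) ?_
  · have h1 : Measurable fun k : ℤ => f (((k : ℝ) + 1) / ((n : ℝ) + 1)) := measurable_of_countable _
    exact h1.comp (Int.measurable_floor.comp (measurable_const.mul measurable_id))
  · refine tendsto_pi_nhds.2 fun x => (h x).tendsto.comp (tendsto_nhdsWithin_iff.2 ⟨?_, ?_⟩)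
    · have h0 : Tendsto (fun n : ℕ => x + 1 / ((n : ℝ) + 1)) atTop (𝓝 (x + 0)) :=
        tendsto_const_nhds.add tendsto_one_div_add_atTop_nhds_zero_nat
      rw [add_zero] at h0
      refine tendsto_of_tendsto_of_tendsto_of_le_of_le tendsto_const_nhds h0 (fun n => ?_)
        fun n => ?_
      · have hn : (0 : ℝ) < (n : ℝ) + 1 := by positivity
        simp only
        rw [le_div_iff₀ hn]
        linarith [Int.lt_floor_add_one (((n : ℝ) + 1) * x)]
      · have hn : (0 : ℝ) < (n : ℝ) + 1 := by positivity
        simp only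
        rw [div_le_iff₀ hn, add_mul x, one_div, inv_mul_cancel₀ hn.ne']
        linarith [Int.floor_le (((n : ℝ) + 1) * x)]
    · refine Eventually.of_forall fun n => ?_
      have hn : (0 : ℝ) < (n : ℝ) + 1 := by positivity
      rw [mem_Ici, le_div_iff₀ hn]
      linarith [Int.lt_floor_add_one (((n : ℝ) + 1) * x)]

section Integral

variable {T : Set ℝ} {a b : ℝ} {f : ℝ → ℝ}

/-- To the right of `x` the step function is locally constant unless `x` is a right-dense point of
`T`, and there rd-continuity of `f` applies. -/
theorem step_continuousWithinAt_Ici (hT : IsClosed T) (ha : IsLeast T a) (hb : IsGreatest T b)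
    (hf : RdContinuousOn T (upperKappa T) f) (x : ℝ) :
    ContinuousWithinAt (step T a f) (Ici x) x := by
  have hconst : ∀ r, x < r → (∀ z, x ≤ z → z < r → step T a f z = step T a f x) →
      ContinuousWithinAt (step T a f) (Ici x) x := by
    intro r hr H
    refine tendsto_const_nhds.congr' ?_
    filter_upwards [self_mem_nhdsWithin, nhdsWithin_le_nhds (Iio_mem_nhds hr)] with z hz hz'
    exact (H z hz hz').symm
  rcases lt_or_ge x a with hxa | hax
  · refine hconst a hxa fun z _ hz => ?_
    rw [step, step, max_eq_left hz.le, max_eq_left hxa.le]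
  rcases lt_or_ge x b with hxb | hbx
  · have htT := floor_mem hT ha.1 hax
    have htx := floor_le ha.1 hax
    rcases lt_or_ge x (sigma T (floor T x)) with hx | hx
    · refine hconst _ hx fun z hz hz' => ?_
      rw [step, step, max_eq_right hax, max_eq_right (hax.trans hz),
        floor_eq_of_lt_sigma hT htT (htx.trans hz) hz']
    -- Here `σ (floor x) ≤ x` lies in `T`, so it cannot exceed `floor x`. Thus `floor x` is
    -- right-dense, and no room remains between it and `x`.
    · have h1 : sigma T (floor T x) = floor T x :=
        le_antisymm (le_floor (sigma_mem hT htT) hx) (le_sigma T _)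
      have h2 : x = floor T x := by
        refine le_antisymm ?_ htx
        by_contra! hlt
        obtain ⟨s, hs, h3, h4⟩ := exists_mem_Ioo_of_sigma_eq h1 hb.1 (htx.trans_lt hxb) hlt
        exact absurd (le_floor hs h4.le) (not_le.2 h3)
      have hxT : x ∈ T := h2 ▸ htT
      rw [← h2] at h1
      have hk := mem_upperKappa_of_lt hxT hb.1 hxb
      have h3 := ((hf x hk).1 h1).tendsto
      rw [ContinuousWithinAt, step_of_mem ha hxT]
      refine h3.comp (tendsto_nhdsWithin_iff.2 ⟨?_, ?_⟩)
      · refine tendsto_of_tendsto_of_tendsto_of_le_of_le' tendsto_const_nhds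
          (tendsto_id.mono_left nhdsWithin_le_nhds : Tendsto id (𝓝[≥] x) (𝓝 x)) ?_ ?_
        · filter_upwards [self_mem_nhdsWithin] with z hz
          rw [max_eq_right (hax.trans hz)]
          exact le_floor hxT hz
        · filter_upwards [self_mem_nhdsWithin] with z hz
          rw [max_eq_right (hax.trans hz)]
          exact floor_le hxT hz
      · filter_upwards [self_mem_nhdsWithin, nhdsWithin_le_nhds (Iio_mem_nhds hxb)] with z hz hzb
        rw [max_eq_right (hax.trans hz)]
        exact mem_upperKappa_of_lt (floor_mem hT hxT hz) hb.1 ((floor_le hxT hz).trans_lt hzb)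
  · have : ∀ z, b ≤ z → floor T z = b := fun z hz =>
      le_antisymm (hb.2 (floor_mem hT hb.1 hz)) (le_floor hb.1 hz)
    refine hconst (x + 1) (by linarith) fun z hz _ => ?_
    rw [step, step, max_eq_right hax, max_eq_right (hax.trans hz), this _ hbx,
      this _ (hbx.trans hz)]

theorem isCompact_of_isLeast_isGreatest (hT : IsClosed T) (ha : IsLeast T a)
    (hb : IsGreatest T b) : IsCompact T :=
  isCompact_Icc.of_isClosed_subset hT fun _ ht => ⟨ha.2 ht, hb.2 ht⟩

theorem abs_step_le (hT : IsClosed T) (ha : IsLeast T a) {R : ℝ} (hR : ∀ t ∈ T, |f t| ≤ R)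
    (x : ℝ) : |step T a f x| ≤ R :=
  hR _ (floor_mem hT ha.1 (le_max_left a x))

theorem intervalIntegrable_step (hT : IsClosed T) (ha : IsLeast T a) (hb : IsGreatest T b)
    (hf : RdContinuousOn T (upperKappa T) f) (c d : ℝ) :
    IntervalIntegrable (step T a f) MeasureTheory.volume c d := by
  obtain ⟨R, hR⟩ := hf.exists_bound (isCompact_of_isLeast_isGreatest hT ha hb)
  have hm := measurable_of_continuousWithinAt_Ici (step_continuousWithinAt_Ici hT ha hb hf)
  rw [intervalIntegrable_iff]
  exact MeasureTheory.Measure.integrableOn_of_bounded (M := R) (by simp)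
    hm.aestronglyMeasurable (Eventually.of_forall fun x => abs_step_le hT ha hR x)

theorem continuous_integral_step (hT : IsClosed T) (ha : IsLeast T a) (hb : IsGreatest T b)
    (hf : RdContinuousOn T (upperKappa T) f) :
    Continuous fun t => ∫ x in a..t, step T a f x :=
  intervalIntegral.continuous_primitive (intervalIntegrable_step hT ha hb hf) a

/-- At a right-dense `t` the integrand between `s` and `t` takes values of `f` at points of `T` no
farther from `t` than `s`. At a right-scattered `t` the gap contributes exactly `f t * (σ t - t)`,
and the rest is at most a multiple of `|t - s|`. -/
theorem hasDeltaDeriv_integral_step (hT : IsClosed T) (ha : IsLeast T a) (hb : IsGreatest T b)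
    (hf : RdContinuousOn T (upperKappa T) f) {t : ℝ} (ht : t ∈ upperKappa T) :
    HasDeltaDeriv T (fun t => ∫ x in a..t, step T a f x) (f t) t := by
  have hi := intervalIntegrable_step hT ha hb hf
  obtain ⟨R, hR⟩ := hf.exists_bound (isCompact_of_isLeast_isGreatest hT ha hb)
  have hR0 : 0 ≤ R := (abs_nonneg _).trans (hR a ha.1)
  have key : ∀ p q : ℝ, (∫ x in a..p, step T a f x) - (∫ x in a..q, step T a f x)
      - f t * (p - q) = ∫ x in q..p, (step T a f x - f t) := by
    intro p q
    rw [intervalIntegral.integral_interval_sub_left (hi _ _) (hi _ _),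
      intervalIntegral.integral_sub (hi _ _) intervalIntegrable_const,
      intervalIntegral.integral_const, smul_eq_mul, mul_comm]
  intro ε hε
  by_cases h : sigma T t = t
  · have h1 := Metric.continuousWithinAt_iff.1 ((hf t ht).1 h) ε hε
    obtain ⟨δ, hδ, H⟩ := h1
    -- Continuity of `f` at `t` is known only within `T^κ`; the one point of `T` that may be missing
    -- there is `b`, and then `t < b`.
    have hbd : ∃ δ' > 0, ∀ s ∈ T, |s - t| < δ' → s ∈ upperKappa T := by
      rcases (hb.2 ht.1).eq_or_lt with htb | htb
      · refine ⟨1, one_pos, fun s hs _ => ?_⟩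
        rcases (hb.2 hs).eq_or_lt with hsb | hsb
        · rw [hsb, ← htb]; exact ht
        · exact mem_upperKappa_of_lt hs hb.1 hsb
      · refine ⟨b - t, by linarith, fun s hs hst => mem_upperKappa_of_lt hs hb.1 ?_⟩
        linarith [(abs_lt.1 hst).2]
    obtain ⟨δ', hδ', H'⟩ := hbd
    refine ⟨min δ δ', lt_min hδ hδ', fun s hs hst => ?_⟩
    rw [key, h]
    rw [← Real.norm_eq_abs]
    refine intervalIntegral.norm_integral_le_of_norm_le_const fun x hx => ?_
    have hx' := uIoc_subset_uIcc hx
    have has := ha.2 hs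
    have hat := ha.2 ht.1
    have h2 : |floor T x - t| ≤ |s - t| ∧ a ≤ x := by
      rcases le_total s t with hle | hle
      · rw [uIcc_of_le hle] at hx'
        have h3 := le_floor hs hx'.1
        have h4 := floor_le hs hx'.1
        rw [abs_of_nonpos (by linarith [hx'.2]), abs_of_nonpos (by linarith)]
        exact ⟨by linarith, has.trans hx'.1⟩
      · rw [uIcc_of_ge hle] at hx'
        have h3 := le_floor ht.1 hx'.1
        have h4 := floor_le ht.1 hx'.1
        rw [abs_of_nonneg (by linarith), abs_of_nonneg (by linarith)]
        exact ⟨by linarith [hx'.2], hat.trans hx'.1⟩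
    have h3 := floor_mem hT ha.1 h2.2
    have h4 := h2.1.trans_lt hst
    have h5 := H (H' _ h3 (h4.trans_le (min_le_right _ _))) (h4.trans_le (min_le_left _ _))
    rw [step, max_eq_right h2.2]
    exact h5.le
  · have hlt : t < sigma T t := lt_of_le_of_ne (le_sigma T t) (Ne.symm h)
    set μ := sigma T t - t with hμ
    have hμ0 : 0 < μ := by linarith
    -- The bound `μ` forces `s ≤ t`, hence `μ ≤ |σ t - s|`. The second bound gives `2 R |t - s| ≤ ε
    -- μ`; the `+ 1` keeps the denominator positive.
    refine ⟨min μ (ε * μ / (2 * R + 1)), lt_min hμ0 (by positivity), fun s hs hst => ?_⟩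
    have hst' : s ≤ t := by
      by_contra! hts
      have := sigma_le hs hts
      have := (abs_lt.1 (hst.trans_le (min_le_left _ _))).2
      linarith
    have h1 : |s - t| < ε * μ / (2 * R + 1) := hst.trans_le (min_le_right _ _)
    rw [key, ← intervalIntegral.integral_add_adjacent_intervals (b := t)
      ((hi _ _).sub intervalIntegrable_const) ((hi _ _).sub intervalIntegrable_const)]
    have h2 : ∫ x in t..sigma T t, (step T a f x - f t) = 0 := by
      refine intervalIntegral.integral_zero_ae ?_
      have h0 : ∀ᵐ x : ℝ, x ≠ sigma T t := by
        simp [MeasureTheory.ae_iff]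
      filter_upwards [h0] with x hx0 hx
      rw [uIoc_of_le hlt.le] at hx
      rw [step, max_eq_right ((ha.2 ht.1).trans hx.1.le),
        floor_eq_of_lt_sigma hT ht.1 hx.1.le (lt_of_le_of_ne hx.2 hx0), sub_self]
    rw [h2, add_zero]
    have h3 : |∫ x in s..t, (step T a f x - f t)| ≤ (2 * R) * |t - s| := by
      rw [← Real.norm_eq_abs]
      refine intervalIntegral.norm_integral_le_of_norm_le_const fun x _ => ?_
      refine (norm_sub_le _ _).trans ?_
      have := abs_step_le hT ha hR x
      have := hR t ht.1
      simp only [Real.norm_eq_abs]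
      linarith
    rw [lt_div_iff₀ (by positivity), abs_sub_comm] at h1
    have h4 : μ ≤ |sigma T t - s| := by rw [abs_of_nonneg (by linarith)]; linarith
    have h5 := mul_le_mul_of_nonneg_left h4 hε.le
    have := abs_nonneg (t - s)
    linarith

/-- An rd-continuous function that is the delta derivative of a continuous function integrates to
the increment of the latter. -/
theorem integral_step_eq_sub (hT : IsClosed T) (ha : IsLeast T a) (hb : IsGreatest T b)
    (hf : RdContinuousOn T (upperKappa T) f) {F : ℝ → ℝ} (hc : ContinuousOn F T)
    (hF : ∀ t ∈ T ∩ Ico a b, HasDeltaDeriv T F (f t) t) :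
    ∫ x in a..b, step T a f x = F b - F a := by
  have h := eq_of_hasDeltaDeriv_zero hT ha hb
    (f := fun t => F t - ∫ x in a..t, step T a f x)
    (hc.sub (continuous_integral_step hT ha hb hf).continuousOn) fun t ht => by
      have := (hF t ht).sub (hasDeltaDeriv_integral_step hT ha hb hf
        (mem_upperKappa_of_lt ht.1 hb.1 ht.2.2))
      rwa [sub_self] at this
  simp only [intervalIntegral.integral_same, sub_zero] at h
  linarith

end Integral

/-! ### Lagrangians -/

theorem IsLagrangian.continuous_partial2 {T : Set ℝ} {L : ℝ → ℝ → ℝ → ℝ} (hL : IsLagrangian T L)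
    {t : ℝ} (ht : t ∈ T) (v : ℝ) : Continuous fun z => partial2 L t z v :=
  hL.cont2.comp_continuous (f := fun z : ℝ => (t, z, v)) (by fun_prop)
    fun z => ⟨ht, mem_univ _⟩

theorem IsLagrangian.continuous_partial3 {T : Set ℝ} {L : ℝ → ℝ → ℝ → ℝ} (hL : IsLagrangian T L)
    {t : ℝ} (ht : t ∈ T) (x : ℝ) : Continuous fun w => partial3 L t x w :=
  hL.cont3.comp_continuous (f := fun w : ℝ => (t, x, w)) (by fun_prop)
    fun w => ⟨ht, mem_univ _⟩

/-- The difference is `∫₀ˣ ∂₂L(t, z, v) dz + ∫₀ᵛ ∂₃L(t, 0, w) dw`, and parametric integrals of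
continuous functions are continuous. Subtracting `L(t, 0, 0)` is essential, as it may be
discontinuous in `t`. -/
theorem IsLagrangian.continuousOn_sub {T : Set ℝ} {L : ℝ → ℝ → ℝ → ℝ} (hL : IsLagrangian T L) :
    ContinuousOn (fun p : ℝ × ℝ × ℝ => L p.1 p.2.1 p.2.2 - L p.1 0 0) (T ×ˢ univ) := by
  rw [continuousOn_iff_continuous_domRestrict]
  have h2 : Continuous fun p : ↥(T ×ˢ (univ : Set (ℝ × ℝ))) =>
      ∫ z in (0 : ℝ)..p.1.2.1, partial2 L p.1.1 z p.1.2.2 := by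
    refine intervalIntegral.continuous_parametric_intervalIntegral_of_continuous ?_ (by fun_prop)
    exact hL.cont2.comp_continuous
      (f := fun q : ↥(T ×ˢ (univ : Set (ℝ × ℝ))) × ℝ => (q.1.1.1, q.2, q.1.1.2.2)) (by fun_prop)
      fun q => ⟨q.1.2.1, mem_univ _⟩
  have h3 : Continuous fun p : ↥(T ×ˢ (univ : Set (ℝ × ℝ))) =>
      ∫ w in (0 : ℝ)..p.1.2.2, partial3 L p.1.1 0 w := by
    refine intervalIntegral.continuous_parametric_intervalIntegral_of_continuous ?_ (by fun_prop)
    exact hL.cont3.comp_continuous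
      (f := fun q : ↥(T ×ˢ (univ : Set (ℝ × ℝ))) × ℝ => (q.1.1.1, 0, q.2)) (by fun_prop)
      fun q => ⟨q.1.2.1, mem_univ _⟩
  refine (h2.add h3).congr fun ⟨⟨t, x, v⟩, ht, _⟩ => ?_
  have e2 : ∫ z in (0 : ℝ)..x, partial2 L t z v = L t x v - L t 0 v :=
    intervalIntegral.integral_deriv_eq_sub (f := fun z => L t z v)
      (fun z _ => hL.diff2 t ht z v) ((hL.continuous_partial2 ht v).intervalIntegrable _ _)
  have e3 : ∫ w in (0 : ℝ)..v, partial3 L t 0 w = L t 0 v - L t 0 0 :=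
    intervalIntegral.integral_deriv_eq_sub (f := fun w => L t 0 w)
      (fun w _ => hL.diff3 t ht 0 w) ((hL.continuous_partial3 ht 0).intervalIntegrable _ _)
  simp only [Pi.add_apply, domRestrict_apply, e2, e3]
  ring

theorem abs_sub_sub_deriv_mul_le {φ : ℝ → ℝ} {p q c δ : ℝ} (hφ : Differentiable ℝ φ)
    (h : ∀ z ∈ uIcc p q, |deriv φ z - c| ≤ δ) : |φ q - φ p - c * (q - p)| ≤ δ * |q - p| := by
  have h1 := (convex_uIcc p q).norm_image_sub_le_of_norm_deriv_le (f := fun z => φ z - c * z)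
    (C := δ) (x := p) (y := q) (fun z _ => (hφ z).sub (by fun_prop)) (fun z hz => by
      have : deriv (fun z => φ z - c * z) z = deriv φ z - c := by
        have h3 : HasDerivAt (fun z => c * z) c z := by
          simpa using (hasDerivAt_id z).const_mul c
        exact ((hφ z).hasDerivAt.sub h3).deriv
      rw [this]
      exact h z hz) left_mem_uIcc right_mem_uIcc
  have h2 : φ q - c * q - (φ p - c * p) = φ q - φ p - c * (q - p) := by ring
  rwa [h2] at h1

/-- The first-order expansion of a Lagrangian is uniform on bounded sets. -/
theorem IsLagrangian.exists_uniform_expansion {T : Set ℝ} (hT : IsCompact T)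
    {L : ℝ → ℝ → ℝ → ℝ} (hL : IsLagrangian T L) {R : ℝ} (hR : 0 ≤ R) {δ : ℝ} (hδ : 0 < δ) :
    ∃ r > 0, ∀ e : ℝ, |e| ≤ r → ∀ t ∈ T, ∀ p q h k : ℝ, |p| ≤ R → |q| ≤ R → |h| ≤ R → |k| ≤ R →
      |L t (p + e * h) (q + e * k) - L t p q
        - e * (partial2 L t p q * h + partial3 L t p q * k)| ≤ δ * |e| := by
  have hK : IsCompact (T ×ˢ (Icc (-(2 * R)) (2 * R) ×ˢ Icc (-(2 * R)) (2 * R))) :=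
    hT.prod (isCompact_Icc.prod isCompact_Icc)
  have hsub : T ×ˢ (Icc (-(2 * R)) (2 * R) ×ˢ Icc (-(2 * R)) (2 * R)) ⊆
      T ×ˢ (univ : Set (ℝ × ℝ)) := prod_mono_right (subset_univ _)
  -- For `|e| ≤ 1` the perturbed arguments stay in the box of radius `2 R`. The increments in `x`
  -- and in `v` each cost at most `δ / (2 * R + 1) * |e| * R`.
  have hδ' : 0 < δ / (2 * R + 1) := by positivity
  obtain ⟨r₂, hr₂, H2⟩ := Metric.uniformContinuousOn_iff.1
    (hK.uniformContinuousOn_of_continuous (hL.cont2.mono hsub)) _ hδ'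
  obtain ⟨r₃, hr₃, H3⟩ := Metric.uniformContinuousOn_iff.1
    (hK.uniformContinuousOn_of_continuous (hL.cont3.mono hsub)) _ hδ'
  refine ⟨min 1 (min r₂ r₃ / (R + 1)), by positivity, fun e he t ht p q h k hp hq hh hk => ?_⟩
  have he1 : |e| ≤ 1 := he.trans (min_le_left _ _)
  have he2 : |e| ≤ min r₂ r₃ / (R + 1) := he.trans (min_le_right _ _)
  have small : ∀ x, |x| ≤ R → |e * x| ≤ R ∧ |e * x| < min r₂ r₃ := by
    intro x hx
    rw [abs_mul]
    refine ⟨by nlinarith [abs_nonneg e, abs_nonneg x], ?_⟩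
    rw [le_div_iff₀ (by positivity)] at he2
    rcases (abs_nonneg e).eq_or_lt with h0 | h0
    · rw [← h0, zero_mul]; exact lt_min hr₂ hr₃
    · nlinarith [abs_nonneg x]
  have seg : ∀ {x y z : ℝ}, |x| ≤ R → |y| ≤ R → z ∈ uIcc x (x + e * y) →
      z ∈ Icc (-(2 * R)) (2 * R) ∧ |z - x| < min r₂ r₃ := by
    intro x y z hx hy hz
    have h1 : |z - x| ≤ |e * y| := by
      have := abs_sub_left_of_mem_uIcc hz
      simpa using this
    have h2 := small y hy
    refine ⟨abs_le.1 ?_, h1.trans_lt h2.2⟩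
    have := abs_sub_abs_le_abs_sub z x
    linarith [h2.1]
  have hbase : ∀ {x : ℝ}, |x| ≤ R → x ∈ Icc (-(2 * R)) (2 * R) := fun hx =>
    abs_le.1 (hx.trans (by linarith))
  have hq' := seg hq hk (right_mem_uIcc : q + e * k ∈ uIcc q (q + e * k))
  have h2 := abs_sub_sub_deriv_mul_le (φ := fun z => L t z (q + e * k)) (p := p) (q := p + e * h)
    (c := partial2 L t p q) (δ := δ / (2 * R + 1)) (fun z => hL.diff2 t ht z _) fun z hz => by
      have hz' := seg hp hh hz
      refine (H2 (t, z, q + e * k) ⟨ht, hz'.1, hq'.1⟩ (t, p, q) ⟨ht, hbase hp, hbase hq⟩ ?_).le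
      rw [Prod.dist_eq, Prod.dist_eq]
      simp only [dist_self, Real.dist_eq]
      exact max_lt hr₂ (max_lt (hz'.2.trans_le (min_le_left _ _))
        (hq'.2.trans_le (min_le_left _ _)))
  have h3 := abs_sub_sub_deriv_mul_le (φ := fun w => L t p w) (p := q) (q := q + e * k)
    (c := partial3 L t p q) (δ := δ / (2 * R + 1)) (fun w => hL.diff3 t ht p w) fun w hw => by
      have hw' := seg hq hk hw
      refine (H3 (t, p, w) ⟨ht, hbase hp, hw'.1⟩ (t, p, q) ⟨ht, hbase hp, hbase hq⟩ ?_).le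
      rw [Prod.dist_eq, Prod.dist_eq]
      simp only [dist_self, Real.dist_eq]
      exact max_lt hr₃ (max_lt hr₃ (hw'.2.trans_le (min_le_right _ _)))
  have hsum : L t (p + e * h) (q + e * k) - L t p q
        - e * (partial2 L t p q * h + partial3 L t p q * k) =
      (L t (p + e * h) (q + e * k) - L t p (q + e * k)
        - partial2 L t p q * (p + e * h - p)) +
      (L t p (q + e * k) - L t p q - partial3 L t p q * (q + e * k - q)) := by ring
  rw [hsum]
  refine (abs_add_le _ _).trans ((add_le_add h2 h3).trans ?_)
  rw [add_sub_cancel_left, add_sub_cancel_left, abs_mul, abs_mul, ← mul_add, ← mul_add,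
    mul_comm |e|, ← mul_assoc]
  refine mul_le_mul_of_nonneg_right ?_ (abs_nonneg e)
  rw [div_mul_eq_mul_div, div_le_iff₀ (by positivity)]
  exact mul_le_mul_of_nonneg_left (by linarith) hδ.le

/-! ### The delta variational problem -/

/-- `y` is rd-continuously delta differentiable with delta derivative `y'`. -/
structure IsRdC1 (T : Set ℝ) (y y' : ℝ → ℝ) : Prop where
  deriv : ∀ t ∈ upperKappa T, HasDeltaDeriv T y (y' t) t
  rd : RdContinuousOn T (upperKappa T) y'

/-- `y` minimizes `∫ L(t, y(σ t), y^Δ t) Δt` under fixed boundary values. -/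
structure IsDeltaMinimizer (T : Set ℝ) (a b : ℝ) (L : ℝ → ℝ → ℝ → ℝ) (y y' : ℝ → ℝ) : Prop where
  rdC1 : IsRdC1 T y y'
  min : ∃ J, HasDeltaIntegral T a b (fun t => L t (y (sigma T t)) (y' t)) J ∧
    ∀ z z' J', IsRdC1 T z z' → z a = y a → z b = y b →
      HasDeltaIntegral T a b (fun t => L t (z (sigma T t)) (z' t)) J' → J ≤ J'

variable {T : Set ℝ} {a b : ℝ} {L : ℝ → ℝ → ℝ → ℝ} {y y' : ℝ → ℝ}

/-- A point of `T` outside `T^κ` is isolated in `T`, so continuity there is automatic. -/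
theorem IsRdC1.continuousOn (h : IsRdC1 T y y') : ContinuousOn y T := by
  intro t ht
  by_cases hk : t ∈ upperKappa T
  · exact (h.deriv t hk).continuousWithinAt ht
  · have hk' : IsGreatest T t ∧ rho T t < t := by
      by_contra H
      exact hk ⟨ht, H⟩
    refine (continuousWithinAt_singleton (f := y) (x := t)).mono_of_mem_nhdsWithin ?_
    refine mem_nhdsWithin_iff_eventually.2 ?_
    filter_upwards [Ioi_mem_nhds hk'.2] with s hs hsT
    rcases (hk'.1.2 hsT).eq_or_lt with h1 | h1
    · exact h1
    · exact absurd (le_rho hsT h1) (not_le.2 hs)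

theorem IsRdC1.add_const_mul (h : IsRdC1 T y y') {η η' : ℝ → ℝ} (hη : IsRdC1 T η η') (e : ℝ) :
    IsRdC1 T (fun t => y t + e * η t) (fun t => y' t + e * η' t) where
  deriv t ht := (h.deriv t ht).add ((hη.deriv t ht).const_mul e)
  rd := h.rd.comp₂ (upperKappa_subset T) hη.rd (Φ := fun p => p.2.1 + e * p.2.2) (by fun_prop)

/-- The possibly discontinuous term `L(t, 0, 0)` cancels in the difference. This is what makes the
cost of every variation exist once that of `y` does. -/
theorem IsLagrangian.rdContinuousOn_sub (hT : IsClosed T) (hL : IsLagrangian T L)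
    (hy : IsRdC1 T y y') {z z' : ℝ → ℝ} (hz : IsRdC1 T z z') :
    RdContinuousOn T (upperKappa T)
      fun t => L t (z (sigma T t)) (z' t) - L t (y (sigma T t)) (y' t) := by
  have hk := upperKappa_subset T
  have h1 := (rdContinuousOn_comp_sigma hT hk (hy.continuousOn)).comp₂ hk hy.rd
    hL.continuousOn_sub
  have h2 := (rdContinuousOn_comp_sigma hT hk (hz.continuousOn)).comp₂ hk hz.rd
    hL.continuousOn_sub
  have h3 := h2.sub hk h1
  simpa only [sub_sub_sub_cancel_right] using h3

/-- The first variation of a minimizer vanishes. -/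
theorem IsDeltaMinimizer.integral_eq_zero (hT : IsClosed T) (ha : IsLeast T a)
    (hb : IsGreatest T b) (hL : IsLagrangian T L) (hy : IsDeltaMinimizer T a b L y y')
    {η η' : ℝ → ℝ} (hη : IsRdC1 T η η') (hηa : η a = 0) (hηb : η b = 0) :
    ∫ x in a..b, step T a (fun t => partial2 L t (y (sigma T t)) (y' t) * η (sigma T t)
      + partial3 L t (y (sigma T t)) (y' t) * η' t) x = 0 := by
  obtain ⟨hyC, J, ⟨F, hFc, hFd, hJ⟩, hmin⟩ := hy
  have hk := upperKappa_subset T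
  have hTc := isCompact_of_isLeast_isGreatest hT ha hb
  have hab : a ≤ b := ha.2 hb.1
  have rp := rdContinuousOn_comp_sigma hT hk (hyC.continuousOn)
  have rh := rdContinuousOn_comp_sigma hT hk (hη.continuousOn)
  have rq := hyC.rd
  have rk := hη.rd
  set W : ℝ → ℝ := fun t => partial2 L t (y (sigma T t)) (y' t) * η (sigma T t)
      + partial3 L t (y (sigma T t)) (y' t) * η' t with hW
  have rW : RdContinuousOn T (upperKappa T) W :=
    ((rp.comp₂ hk rq hL.cont2).mul hk rh).add hk ((rp.comp₂ hk rq hL.cont3).mul hk rk)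
  set D : ℝ → ℝ → ℝ := fun e t => L t (y (sigma T t) + e * η (sigma T t)) (y' t + e * η' t)
    - L t (y (sigma T t)) (y' t) with hD
  have rD : ∀ e, RdContinuousOn T (upperKappa T) (D e) := fun e =>
    hL.rdContinuousOn_sub hT hyC (hyC.add_const_mul hη e)
  -- Adding the primitive of `D e` to the given antiderivative `F` yields an antiderivative for `y +
  -- e η`, so this variation is a competitor.
  have hpos : ∀ e, 0 ≤ ∫ x in a..b, step T a (D e) x := by
    intro e
    have := hmin (fun t => y t + e * η t) (fun t => y' t + e * η' t)
      (J + ∫ x in a..b, step T a (D e) x) (hyC.add_const_mul hη e) (by simp [hηa]) (by simp [hηb])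
      ⟨fun t => F t + ∫ x in a..t, step T a (D e) x,
        hFc.add (continuous_integral_step hT ha hb (rD e)).continuousOn, fun t ht => by
          have h1 := (hFd t ht).add (hasDeltaDeriv_integral_step hT ha hb (rD e)
            (mem_upperKappa_of_lt ht.1 hb.1 ht.2.2))
          simpa only [hD, add_sub_cancel] using h1, by
          simp only [intervalIntegral.integral_same, hJ]; ring⟩
    linarith
  obtain ⟨R₁, hR₁⟩ := rp.exists_bound hTc
  obtain ⟨R₂, hR₂⟩ := rq.exists_bound hTc
  obtain ⟨R₃, hR₃⟩ := rh.exists_bound hTc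
  obtain ⟨R₄, hR₄⟩ := rk.exists_bound hTc
  set R := max (max R₁ R₂) (max R₃ R₄) with hRdef
  have l1 : R₁ ≤ R := (le_max_left _ _).trans (le_max_left _ _)
  have l2 : R₂ ≤ R := (le_max_right _ _).trans (le_max_left _ _)
  have l3 : R₃ ≤ R := (le_max_left _ _).trans (le_max_right _ _)
  have l4 : R₄ ≤ R := (le_max_right _ _).trans (le_max_right _ _)
  have hR0 : 0 ≤ R := (abs_nonneg _).trans ((hR₁ a ha.1).trans l1)
  have bound : ∀ δ > 0, |∫ x in a..b, step T a W x| ≤ δ * (b - a) := by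
    intro δ hδ
    obtain ⟨r, hr, H⟩ := hL.exists_uniform_expansion hTc hR0 hδ
    have est : ∀ e : ℝ, |e| ≤ r → |(∫ x in a..b, step T a (D e) x)
        - e * ∫ x in a..b, step T a W x| ≤ δ * |e| * (b - a) := by
      intro e he
      rw [← intervalIntegral.integral_const_mul, ← intervalIntegral.integral_sub
        (intervalIntegrable_step hT ha hb (rD e) _ _)
        ((intervalIntegrable_step hT ha hb rW _ _).const_mul e)]
      have hab' : |b - a| = b - a := abs_of_nonneg (by linarith)
      rw [← Real.norm_eq_abs]
      refine (intervalIntegral.norm_integral_le_of_norm_le_const (C := δ * |e|)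
        fun x _ => ?_).trans_eq (by rw [hab'])
      have hm := floor_mem hT ha.1 (le_max_left a x)
      exact H e he _ hm _ _ _ _ ((hR₁ _ hm).trans l1) ((hR₂ _ hm).trans l2)
        ((hR₃ _ hm).trans l3) ((hR₄ _ hm).trans l4)
    have e1 := abs_le.1 (est r (abs_of_pos hr).le)
    -- Both signs of `e` are needed: `∫ D e ≥ 0` bounds the first variation from below for `e = r`
    -- and from above for `e = -r`.
    have e2 := abs_le.1 (est (-r) (by rw [abs_neg, abs_of_pos hr]))
    rw [abs_of_pos hr] at e1
    rw [abs_neg, abs_of_pos hr] at e2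
    have p1 := hpos r
    have p2 := hpos (-r)
    rw [abs_le]
    constructor
    · refine le_of_mul_le_mul_left ?_ hr
      linarith
    · refine le_of_mul_le_mul_left ?_ hr
      linarith
  have h0 : |∫ x in a..b, step T a W x| ≤ 0 := by
    refine le_of_forall_pos_le_add fun ε hε => ?_
    have hba : 0 ≤ b - a := by linarith
    refine (bound (ε / (b - a + 1)) (by positivity)).trans ?_
    rw [div_mul_eq_mul_div, div_le_iff₀ (by positivity)]
    nlinarith
  exact abs_nonpos_iff.1 h0

theorem eq_of_hasDeltaDeriv (ha : IsLeast T a) (hb : IsGreatest T b) (hab : a < b)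
    {f : ℝ → ℝ} {d e t : ℝ} (ht : t ∈ upperKappa T) (hd : HasDeltaDeriv T f d t)
    (he : HasDeltaDeriv T f e t) : d = e := by
  have h2 : ∃ c ∈ T, c ≠ t := by
    by_cases h : t = a
    · exact ⟨b, hb.1, by rw [h]; exact hab.ne'⟩
    · exact ⟨a, ha.1, Ne.symm h⟩
  obtain ⟨c, hcT, hct⟩ := h2
  exact hd.unique he (frequently_ne_sigma ht hcT hct)

/-- The Euler–Lagrange equation in integrated form: along a minimizer, `∂₃L` agrees on `T^κ` with a
delta antiderivative of `∂₂L`. -/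
theorem IsDeltaMinimizer.exists_antideriv (hT : IsClosed T) (ha : IsLeast T a)
    (hb : IsGreatest T b) (hab : a < b) (hL : IsLagrangian T L)
    (hy : IsDeltaMinimizer T a b L y y') :
    ∃ P : ℝ → ℝ, (∀ t ∈ upperKappa T, partial3 L t (y (sigma T t)) (y' t) = P t) ∧
      ∀ t ∈ upperKappa T, HasDeltaDeriv T P (partial2 L t (y (sigma T t)) (y' t)) t := by
  have hk := upperKappa_subset T
  have rp := rdContinuousOn_comp_sigma hT hk (hy.rdC1.continuousOn)
  have rA := rp.comp₂ hk hy.rdC1.rd hL.cont2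
  have rB := rp.comp₂ hk hy.rdC1.rd hL.cont3
  set A : ℝ → ℝ := fun t => partial2 L t (y (sigma T t)) (y' t) with hA
  set B : ℝ → ℝ := fun t => partial3 L t (y (sigma T t)) (y' t) with hB
  set P : ℝ → ℝ := fun t => ∫ x in a..t, step T a A x with hP
  have cP : Continuous P := continuous_integral_step hT ha hb rA
  have dP : ∀ t ∈ upperKappa T, HasDeltaDeriv T P (A t) t := fun t ht =>
    hasDeltaDeriv_integral_step hT ha hb rA ht
  have rBP := rB.sub hk (rdContinuousOn_of_continuousOn hk cP.continuousOn)
  -- The mean value of `B - P` over `[a, b]`, so that the variation `η` with derivative `B - P - c`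
  -- vanishes at `b`.
  set c : ℝ := (∫ x in a..b, step T a (fun t => B t - P t) x) / (b - a) with hc
  set e : ℝ → ℝ := fun t => B t - P t - c with he
  have re : RdContinuousOn T (upperKappa T) e :=
    rBP.sub hk (rdContinuousOn_of_continuousOn hk continuousOn_const)
  set η : ℝ → ℝ := fun t => ∫ x in a..t, step T a e x with hη
  have ηC : IsRdC1 T η e := ⟨fun t ht => hasDeltaDeriv_integral_step hT ha hb re ht, re⟩
  have ηa : η a = 0 := intervalIntegral.integral_same
  have ηb : η b = 0 := by
    have h1 : η b = ∫ x in a..b, (step T a (fun t => B t - P t) x - c) := rfl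
    rw [h1, intervalIntegral.integral_sub (intervalIntegrable_step hT ha hb rBP _ _)
      intervalIntegrable_const, intervalIntegral.integral_const, smul_eq_mul, hc,
      mul_div_cancel₀ _ (sub_pos.2 hab).ne', sub_self]
  have v1 := hy.integral_eq_zero hT ha hb hL ηC ηa ηb
  have rσ := rdContinuousOn_comp_sigma hT hk (ηC.continuousOn)
  have r2 : RdContinuousOn T (upperKappa T) fun t => η (sigma T t) * A t + e t * P t :=
    (rσ.mul hk rA).add hk (re.mul hk (rdContinuousOn_of_continuousOn hk cP.continuousOn))
  -- Integration by parts: the integrand is the delta derivative of `η P`, and `η` vanishes at both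
  -- ends.
  have v2 := integral_step_eq_sub hT ha hb r2 (F := fun t => η t * P t)
    ((ηC.continuousOn).mul cP.continuousOn) fun t ht => by
      have htk := mem_upperKappa_of_lt ht.1 hb.1 ht.2.2
      exact (ηC.deriv t htk).mul ht.1 (dP t htk)
  rw [ηa, ηb, zero_mul, zero_mul, sub_zero] at v2
  have r1 : RdContinuousOn T (upperKappa T) fun t => A t * η (sigma T t) + B t * e t :=
    (rA.mul hk rσ).add hk (rB.mul hk re)
  have ree := re.mul hk re
  have v3 : ∫ x in a..b, step T a (fun t => e t * e t) x = 0 := by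
    have i1 := intervalIntegrable_step hT ha hb r1 a b
    have i2 := intervalIntegrable_step hT ha hb r2 a b
    have i3 := (intervalIntegrable_step hT ha hb re a b).const_mul c
    -- Since `e = B - P - c`, its square is the first variation minus the integration-by-parts
    -- integrand minus `c e`; each of the three integrates to zero.
    have h1 : ∀ x, step T a (fun t => e t * e t) x =
        step T a (fun t => A t * η (sigma T t) + B t * e t) x
          - step T a (fun t => η (sigma T t) * A t + e t * P t) x - c * step T a e x := by
      intro x
      simp only [step, he]
      ring
    rw [intervalIntegral.integral_congr fun x _ => h1 x,
      intervalIntegral.integral_sub (i1.sub i2) i3, intervalIntegral.integral_sub i1 i2,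
      intervalIntegral.integral_const_mul, v1, v2]
    have h2 : ∫ x in a..b, step T a e x = 0 := ηb
    rw [h2]
    simp
  -- A nonnegative integrand of total integral zero has vanishing primitive. Its delta derivative is
  -- then both `e²` and `0`, and uniqueness gives `e = 0` at every point of `T^κ`, with no appeal to
  -- almost-everywhere statements.
  have hzero : ∀ t ∈ T, ∫ x in a..t, step T a (fun t => e t * e t) x = 0 := by
    intro t ht
    have hnn : ∀ x, 0 ≤ step T a (fun t => e t * e t) x := fun x => mul_self_nonneg _
    have hi := intervalIntegrable_step hT ha hb ree
    have h1 := intervalIntegral.integral_nonneg (μ := MeasureTheory.volume) (ha.2 ht)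
      fun x _ => hnn x
    have h2 := intervalIntegral.integral_nonneg (μ := MeasureTheory.volume) (hb.2 ht)
      fun x _ => hnn x
    have h3 := intervalIntegral.integral_add_adjacent_intervals (hi a t) (hi t b)
    linarith
  have he0 : ∀ t ∈ upperKappa T, e t = 0 := by
    intro t ht
    have h1 := (hasDeltaDeriv_integral_step hT ha hb ree ht).congr
      (g := fun _ => (0 : ℝ)) (sigma_mem hT ht.1) fun s hs => (hzero s hs).symm
    exact mul_self_eq_zero.1 (eq_of_hasDeltaDeriv ha hb hab ht h1 (hasDeltaDeriv_const T 0 t))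
  refine ⟨fun t => P t + c, fun t ht => ?_, fun t ht => ?_⟩
  · have := he0 t ht
    simp only [he] at this
    linarith
  · simpa using (dP t ht).add (hasDeltaDeriv_const T c t)

/-! ### Contingent epiderivatives of one-sided differentiable functions -/

/-- The hypothesis is differentiability at `t` on the side to which `u` points. The graph then lies
within `o(h)` of `(t + h u, f t + h u d)`, so `u d` is attained. For `v < u d` the epigraph stays at
a distance proportional to `h` from `(t + h u, f t + h v)`. -/
theorem contingentEpideriv_eq {X : Set ℝ} {f : ℝ → ℝ} {t u d : ℝ} (hu : u ≠ 0)
    (H : ∀ ε > 0, ∃ r > 0, ∀ x, 0 < (x - t) * u → |x - t| < r →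
      x ∈ X ∧ |f x - f t - d * (x - t)| ≤ ε * |x - t|) :
    contingentEpideriv X f t u = ((u * d : ℝ) : EReal) := by
  have hu0 : 0 < |u| := abs_pos.2 hu
  have hpos : ∀ᶠ h : ℝ in 𝓝[>] 0, 0 < h := self_mem_nhdsWithin
  have hsmall : ∀ r > 0, ∀ᶠ h : ℝ in 𝓝[>] 0, h < r := fun r hr =>
    nhdsWithin_le_nhds (Iio_mem_nhds hr)
  refine le_antisymm (sInf_le ⟨u * d, ?_, rfl⟩) (le_sInf ?_)
  · refine Tendsto.liminf_eq (ENNReal.tendsto_nhds_zero.2 fun ε hε => ?_)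
    -- The given `ε` may be `⊤`; truncation at `1` makes it a positive real.
    set ε' : ℝ := (min ε 1).toReal with hε'
    have hfin : min ε 1 ≠ ⊤ := ne_top_of_le_ne_top ENNReal.one_ne_top (min_le_right _ _)
    have hε0 : 0 < ε' := ENNReal.toReal_pos (lt_min hε one_pos).ne' hfin
    have hεle : ENNReal.ofReal ε' ≤ ε := by
      rw [hε', ENNReal.ofReal_toReal hfin]; exact min_le_left _ _
    obtain ⟨r, hr, Hr⟩ := H (ε' / |u|) (by positivity)
    filter_upwards [hpos, hsmall (r / |u|) (by positivity)] with h h0 h1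
    refine ENNReal.div_le_of_le_mul (le_trans ?_ (mul_le_mul_left hεle _))
    rw [← ENNReal.ofReal_mul hε0.le]
    have habs : |t + h * u - t| = h * |u| := by
      rw [add_sub_cancel_left, abs_mul, abs_of_pos h0]
    obtain ⟨hX, hE⟩ := Hr (t + h * u)
      (by rw [add_sub_cancel_left, mul_assoc]; exact mul_pos h0 (mul_self_pos.2 hu))
      (by rw [habs]; exact (lt_div_iff₀ hu0).1 h1)
    have hmem : (t + h * u, f (t + h * u)) ∈ graph (epiMap X f) := ⟨hX, le_rfl⟩
    refine (Metric.infEDist_le_edist_of_mem hmem).trans ?_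
    rw [edist_dist]
    refine ENNReal.ofReal_le_ofReal ?_
    rw [Prod.dist_eq]
    simp only [Prod.fst_add, Prod.snd_add, Prod.smul_mk, smul_eq_mul, dist_self]
    refine max_le (by positivity) ?_
    rw [Real.dist_eq, abs_sub_comm]
    rw [habs] at hE
    have e1 : f (t + h * u) - (f t + h * (u * d)) = f (t + h * u) - f t - d * (t + h * u - t) := by
      ring
    have e2 : ε' / |u| * (h * |u|) = ε' * h := by field_simp
    rw [e1, ← e2]
    exact hE
  · rintro _ ⟨v, hv, rfl⟩
    rw [EReal.coe_le_coe_iff]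
    by_contra! hlt
    have hγ : 0 < u * d - v := by linarith
    -- The errors add up to at most `h * (ε * C)`: `1` from the height `l`, `|d|` from the
    -- displacement `θ`, and `|u| + 1` from the differentiability estimate. The bound `ε ≤ |u| / 2`
    -- keeps `x` on the side of `t` to which `u` points.
    set C := 2 + |d| + |u| with hC
    have hC0 : 0 < C := by positivity
    set ε := min (min 1 (|u| / 2)) ((u * d - v) / C) with hεdef
    have hε0 : 0 < ε := lt_min (lt_min one_pos (by positivity)) (by positivity)
    have hε1 : ε ≤ 1 := (min_le_left _ _).trans (min_le_left _ _)
    have hε2 : ε ≤ |u| / 2 := (min_le_left _ _).trans (min_le_right _ _)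
    have hε3 : ε * C ≤ u * d - v := (le_div_iff₀ hC0).1 (min_le_right _ _)
    obtain ⟨r, hr, Hr⟩ := H ε hε0
    have hfr : ∃ᶠ h : ℝ in 𝓝[>] 0, Metric.infEDist ((t, f t) + h • (u, v)) (graph (epiMap X f)) /
        ENNReal.ofReal h < ENNReal.ofReal ε := by
      refine frequently_lt_of_liminf_lt ?_ ?_
      · isBoundedDefault
      · rw [show liminf (fun h : ℝ => Metric.infEDist ((t, f t) + h • (u, v))
          (graph (epiMap X f)) / ENNReal.ofReal h) (𝓝[>] (0 : ℝ)) = 0 from hv]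
        exact ENNReal.ofReal_pos.2 hε0
    obtain ⟨h, hh, h0, h1⟩ :=
      (hfr.and_eventually (hpos.and (hsmall (r / (|u| + 1)) (by positivity)))).exists
    rw [ENNReal.div_lt_iff (Or.inl (ENNReal.ofReal_pos.2 h0).ne') (Or.inl ENNReal.ofReal_ne_top),
      ← ENNReal.ofReal_mul hε0.le, Metric.infEDist_lt_iff] at hh
    obtain ⟨⟨x, l⟩, ⟨-, hl⟩, hd⟩ := hh
    rw [edist_dist, ENNReal.ofReal_lt_ofReal_iff (by positivity), Prod.dist_eq, max_lt_iff] at hd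
    simp only [Prod.fst_add, Prod.snd_add, Prod.smul_mk, smul_eq_mul, Real.dist_eq] at hd hl
    obtain ⟨hx, hl'⟩ := hd
    set θ := t + h * u - x with hθ
    have hxt : x - t = h * u - θ := by rw [hθ]; ring
    have hθu : θ * u ≤ ε * h * |u| := by
      refine (le_abs_self _).trans ?_
      rw [abs_mul]
      exact mul_le_mul_of_nonneg_right hx.le hu0.le
    have hside : 0 < (x - t) * u := by
      rw [hxt]
      have h2 : ε * h * |u| ≤ |u| / 2 * h * |u| := by gcongr
      have h3 : |u| / 2 * h * |u| = h * (u * u) / 2 := by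
        rw [← abs_mul_abs_self u]; ring
      have h4 : 0 < h * (u * u) := mul_pos h0 (mul_self_pos.2 hu)
      nlinarith
    have hnorm : |x - t| ≤ h * (|u| + ε) := by
      rw [hxt]
      refine (abs_sub _ _).trans ?_
      rw [abs_mul, abs_of_pos h0]
      linarith
    have hlt' : |x - t| < r := by
      refine hnorm.trans_lt ?_
      rw [lt_div_iff₀ (by positivity)] at h1
      nlinarith
    have hE := (abs_le.1 (Hr x hside hlt').2).1
    have hdθ : d * θ ≤ |d| * (ε * h) := by
      refine (le_abs_self _).trans ?_
      rw [abs_mul]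
      exact mul_le_mul_of_nonneg_left hx.le (abs_nonneg d)
    have hEb : ε * |x - t| ≤ ε * (h * (|u| + ε)) := mul_le_mul_of_nonneg_left hnorm hε0.le
    have hEb' : ε * (h * (|u| + ε)) ≤ h * (ε * (|u| + 1)) := by
      have : ε * (h * (|u| + ε)) = h * (ε * (|u| + ε)) := by ring
      rw [this]
      gcongr
    have hl'' := (abs_lt.1 hl').1
    have e1 : d * (x - t) = h * (u * d) - d * θ := by rw [hxt]; ring
    rw [e1] at hE
    have hmul := mul_le_mul_of_nonneg_left hε3 h0.le
    have e2 : h * (ε * C) = 2 * (h * ε) + |d| * (ε * h) + h * (ε * |u|) := by rw [hC]; ring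
    have e3 : h * (ε * (|u| + 1)) = h * (ε * |u|) + h * ε := by ring
    have e4 : ε * h = h * ε := mul_comm _ _
    nlinarith

/-! ### One-sided derivatives of the piecewise-affine extension -/

theorem extend_of_mem {S : Set ℝ} {t : ℝ} (ht : t ∈ S) (f : ℝ → ℝ) : extend S f t = f t := by
  rw [extend, if_pos ht]

/-- For `x ∈ S` the gap degenerates to `s = s' = x`. Closedness is asked only inside `[p, q]`,
because `S` will also be `T` without an end point, which is not closed when that end point is dense.
-/
theorem exists_gap {S : Set ℝ} {p q x : ℝ} (hp : p ∈ S) (hq : q ∈ S)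
    (hS : IsClosed (S ∩ Icc p q)) (hx : x ∈ Icc p q) (f : ℝ → ℝ) :
    ∃ s ∈ S, ∃ s' ∈ S, p ≤ s ∧ s ≤ x ∧ x ≤ s' ∧ s' ≤ q ∧ (∀ w ∈ S, w ≤ s ∨ s' ≤ w) ∧
      ∃ k, 0 ≤ k ∧ k ≤ 1 ∧ x = s + k * (s' - s) ∧ extend S f x = f s + k * (f s' - f s) := by
  by_cases hxS : x ∈ S
  · exact ⟨x, hxS, x, hxS, hx.1, le_rfl, le_rfl, hx.2, fun w _ => le_total w x, 0, le_rfl,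
      zero_le_one, by ring, by rw [extend_of_mem hxS]; ring⟩
  obtain ⟨s, ⟨⟨hs, hps, hsq⟩, hsx⟩, hsup⟩ : ∃ s, IsGreatest (S ∩ Icc p q ∩ Iic x) s :=
    ⟨_, (hS.inter isClosed_Iic).isGreatest_csSup ⟨p, ⟨hp, le_rfl, hx.1.trans hx.2⟩, hx.1⟩
      ⟨x, fun _ h => h.2⟩⟩
  obtain ⟨s', ⟨⟨hs', hps', hsq'⟩, hsx'⟩, hinf⟩ : ∃ s, IsLeast (S ∩ Icc p q ∩ Ici x) s :=
    ⟨_, (hS.inter isClosed_Ici).isLeast_csInf ⟨q, ⟨hq, hx.1.trans hx.2, le_rfl⟩, hx.2⟩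
      ⟨x, fun _ h => h.2⟩⟩
  have hlow : ∀ w ∈ S, w ≤ x → w ≤ s := fun w hw hwx => by
    rcases le_total p w with h | h
    · exact hsup ⟨⟨hw, h, hwx.trans hx.2⟩, hwx⟩
    · exact h.trans hps
  have hhigh : ∀ w ∈ S, x ≤ w → s' ≤ w := fun w hw hxw => by
    rcases le_total w q with h | h
    · exact hinf ⟨⟨hw, hx.1.trans hxw, h⟩, hxw⟩
    · exact hsq'.trans h
  have hgap : ∀ w ∈ S, w ≤ s ∨ s' ≤ w := fun w hw =>
    (le_total w x).imp (hlow w hw) (hhigh w hw)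
  have hsx1 : s < x := lt_of_le_of_ne hsx fun h => hxS (h ▸ hs)
  have hsx2 : x < s' := lt_of_le_of_ne hsx' fun h => hxS (h ▸ hs')
  have e1 : sSup (S ∩ Iic x) = s :=
    IsGreatest.csSup_eq ⟨⟨hs, hsx⟩, fun w hw => hlow w hw.1 hw.2⟩
  have e2 : sigma S s = s' := by
    rw [sigma, if_pos ⟨s', hs', hsx1.trans hsx2⟩]
    exact IsLeast.csInf_eq ⟨⟨hs', hsx1.trans hsx2⟩, fun w hw =>
      (hgap w hw.1).resolve_left (not_le.2 hw.2)⟩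
  have hpos : 0 < s' - s := by linarith
  refine ⟨s, hs, s', hs', hps, hsx, hsx', hsq', hgap, (x - s) / (s' - s),
    div_nonneg (by linarith) hpos.le, (div_le_one hpos).2 (by linarith), by field_simp; ring, ?_⟩
  rw [extend, if_neg hxS]
  simp only [e1, e2]
  ring

/-- On one side of `t` the distance `|x - t|` is affine, as is the error along the gap, so a bound
at both ends of the gap passes to its interior. -/
theorem abs_sub_sub_le_of_convexCombo {f : ℝ → ℝ} {s s' t x k d ε y : ℝ} (hk0 : 0 ≤ k)
    (hk1 : k ≤ 1) (hx : x = s + k * (s' - s)) (hy : y = f s + k * (f s' - f s))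
    (h : |f s - f t - d * (s - t)| ≤ ε * |s - t|)
    (h' : |f s' - f t - d * (s' - t)| ≤ ε * |s' - t|)
    (hside : (t ≤ s ∧ t ≤ s') ∨ (s ≤ t ∧ s' ≤ t)) :
    |y - f t - d * (x - t)| ≤ ε * |x - t| := by
  have e1 : y - f t - d * (x - t) =
      (1 - k) * (f s - f t - d * (s - t)) + k * (f s' - f t - d * (s' - t)) := by
    rw [hx, hy]; ring
  have e2 : |x - t| = (1 - k) * |s - t| + k * |s' - t| := by
    have e3 : x - t = (1 - k) * (s - t) + k * (s' - t) := by rw [hx]; ring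
    have hk1' : 0 ≤ 1 - k := by linarith
    rcases hside with ⟨h1, h2⟩ | ⟨h1, h2⟩
    · have p1 := mul_nonneg hk1' (sub_nonneg.2 h1)
      have p2 := mul_nonneg hk0 (sub_nonneg.2 h2)
      rw [abs_of_nonneg (sub_nonneg.2 h1), abs_of_nonneg (sub_nonneg.2 h2), e3,
        abs_of_nonneg (by linarith)]
    · have p1 := mul_nonneg hk1' (sub_nonneg.2 h1)
      have p2 := mul_nonneg hk0 (sub_nonneg.2 h2)
      rw [abs_of_nonpos (sub_nonpos.2 h1), abs_of_nonpos (sub_nonpos.2 h2), e3,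
        abs_of_nonpos (by linarith)]
      ring
  rw [e1, e2]
  refine (abs_add_le _ _).trans ?_
  rw [abs_mul, abs_mul, abs_of_nonneg hk0, abs_of_nonneg (sub_nonneg.2 hk1)]
  nlinarith [mul_le_mul_of_nonneg_left h (sub_nonneg.2 hk1), mul_le_mul_of_nonneg_left h' hk0]

theorem HasNablaDeriv.rho_eq {T : Set ℝ} {f : ℝ → ℝ} {d t : ℝ} (h : HasNablaDeriv T f d t)
    (ht : t ∈ T) : f (rho T t) = f t + d * (rho T t - t) := by
  have h0 : |f (rho T t) - f t - d * (rho T t - t)| ≤ 0 := by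
    refine le_of_forall_pos_le_add fun ε hε => ?_
    have h1 := abs_nonneg (rho T t - t)
    obtain ⟨δ, hδ, H⟩ := h (ε / (|rho T t - t| + 1)) (by positivity)
    refine (H t ht (by simpa using hδ)).trans ?_
    rw [div_mul_eq_mul_div, div_le_iff₀ (by positivity)]
    nlinarith
  have := abs_nonpos_iff.1 h0
  linarith

/-- By convexity it suffices to estimate the error at the two ends of the gap around `x`. If `t` is
right-scattered, this gap is `[t, σ t]` and both errors vanish. -/
theorem HasDeltaDeriv.epiderivExtend_eq {S : Set ℝ} {f : ℝ → ℝ} {d t c u : ℝ}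
    (h : HasDeltaDeriv S f d t) (ht : t ∈ S) (hc : c ∈ S) (htc : t < c)
    (hS : IsClosed (S ∩ Icc t c)) (hu : 0 < u) :
    epiderivExtend S f t u = ((u * d : ℝ) : EReal) := by
  refine contingentEpideriv_eq hu.ne' fun ε hε => ?_
  have hX : ∀ x ∈ Icc t c, x ∈ convexHull ℝ S := fun x hx =>
    (convex_convexHull ℝ S).ordConnected.out (subset_convexHull ℝ S ht)
      (subset_convexHull ℝ S hc) hx
  suffices ∃ r > 0, ∀ x, t < x → x < t + r → x ≤ c ∧ ∀ s ∈ S, ∀ s' ∈ S, t ≤ s → s ≤ x → x ≤ s' →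
      (∀ w ∈ S, w ≤ s ∨ s' ≤ w) → |f s - f t - d * (s - t)| ≤ ε * |s - t| ∧
      |f s' - f t - d * (s' - t)| ≤ ε * |s' - t| by
    obtain ⟨r, hr, H⟩ := this
    refine ⟨r, hr, fun x hx hxr => ?_⟩
    have htx : t < x := sub_pos.1 (pos_of_mul_pos_left hx hu.le)
    obtain ⟨hxc, H⟩ := H x htx (by linarith [(abs_lt.1 hxr).2])
    refine ⟨hX x ⟨htx.le, hxc⟩, ?_⟩
    obtain ⟨s, hs, s', hs', h1, h2, h3, -, h5, k, hk0, hk1, hk, hf⟩ :=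
      exists_gap ht hc hS ⟨htx.le, hxc⟩ f
    obtain ⟨E, E'⟩ := H s hs s' hs' h1 h2 h3 h5
    rw [extend_of_mem ht]
    exact abs_sub_sub_le_of_convexCombo hk0 hk1 hk hf E E' (Or.inl ⟨h1, by linarith⟩)
  by_cases hσ : sigma S t = t
  · obtain ⟨δ, hδ, H⟩ := h ε hε
    -- The right end of the gap around `x` might lie beyond `t + δ`; restricting to `x < q` with `q
    -- ∈ S` close to `t` keeps it below `q`.
    obtain ⟨q, hq, htq, hq'⟩ := exists_mem_Ioo_of_sigma_eq hσ hc htc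
      (lt_min (lt_add_of_pos_right t hδ) htc)
    have hqδ := hq'.trans_le (min_le_left _ _)
    have hqc := hq'.trans_le (min_le_right _ _)
    have H' : ∀ s ∈ S, t ≤ s → s ≤ q → |f s - f t - d * (s - t)| ≤ ε * |s - t| := by
      intro s hs h1 h2
      have := H s hs (by rw [abs_lt]; constructor <;> linarith)
      rw [hσ, abs_sub_comm t s] at this
      rw [← abs_neg]
      convert this using 2
      ring
    refine ⟨q - t, by linarith, fun x hx hxq => ⟨by linarith, fun s hs s' hs' h1 h2 h3 h4 => ?_⟩⟩
    have h5 : s' ≤ q := (h4 q hq).resolve_left (by linarith)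
    exact ⟨H' s hs h1 (by linarith), H' s' hs' (by linarith) h5⟩
  · have hlt : t < sigma S t := lt_of_le_of_ne (le_sigma S t) (Ne.symm hσ)
    have hσc := sigma_le hc htc
    refine ⟨sigma S t - t, by linarith, fun x hx hxq => ⟨by linarith,
      fun s hs s' hs' h1 h2 h3 h4 => ?_⟩⟩
    have e1 : s = t := by
      by_contra hne
      have := sigma_le hs (lt_of_le_of_ne h1 (Ne.symm hne))
      linarith
    subst e1
    have e2 : sigma S s = s' := by
      rw [sigma, if_pos ⟨s', hs', hx.trans_le h3⟩]
      exact IsLeast.csInf_eq ⟨⟨hs', hx.trans_le h3⟩, fun w hw =>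
        (h4 w hw.1).resolve_left (not_le.2 hw.2)⟩
    have e3 := h.sigma_eq ht
    rw [e2] at e3
    rw [e3]
    have : f s + d * (s' - s) - f s - d * (s' - s) = 0 := by ring
    rw [this]
    simp only [sub_self, mul_zero, abs_zero, le_refl, true_and]
    positivity

theorem HasNablaDeriv.epiderivExtend_eq {S : Set ℝ} {f : ℝ → ℝ} {d t c u : ℝ}
    (h : HasNablaDeriv S f d t) (ht : t ∈ S) (hc : c ∈ S) (htc : c < t)
    (hS : IsClosed (S ∩ Icc c t)) (hu : u < 0) :
    epiderivExtend S f t u = ((u * d : ℝ) : EReal) := by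
  refine contingentEpideriv_eq hu.ne fun ε hε => ?_
  have hX : ∀ x ∈ Icc c t, x ∈ convexHull ℝ S := fun x hx =>
    (convex_convexHull ℝ S).ordConnected.out (subset_convexHull ℝ S hc)
      (subset_convexHull ℝ S ht) hx
  suffices ∃ r > 0, ∀ x, x < t → t - r < x → c ≤ x ∧ ∀ s ∈ S, ∀ s' ∈ S, s' ≤ t → s ≤ x → x ≤ s' →
      (∀ w ∈ S, w ≤ s ∨ s' ≤ w) → |f s - f t - d * (s - t)| ≤ ε * |s - t| ∧
      |f s' - f t - d * (s' - t)| ≤ ε * |s' - t| by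
    obtain ⟨r, hr, H⟩ := this
    refine ⟨r, hr, fun x hx hxr => ?_⟩
    have htx : x < t := sub_neg.1 (neg_of_mul_pos_left hx hu.le)
    obtain ⟨hxc, H⟩ := H x htx (by linarith [(abs_lt.1 hxr).1])
    refine ⟨hX x ⟨hxc, htx.le⟩, ?_⟩
    obtain ⟨s, hs, s', hs', -, h2, h3, h1, h5, k, hk0, hk1, hk, hf⟩ :=
      exists_gap hc ht hS ⟨hxc, htx.le⟩ f
    obtain ⟨E, E'⟩ := H s hs s' hs' h1 h2 h3 h5
    rw [extend_of_mem ht]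
    exact abs_sub_sub_le_of_convexCombo hk0 hk1 hk hf E E' (Or.inr ⟨by linarith, h1⟩)
  by_cases hρ : rho S t = t
  · obtain ⟨δ, hδ, H⟩ := h ε hε
    obtain ⟨q, hq, hq', htq⟩ := exists_mem_Ioo_of_rho_eq hρ hc htc
      (max_lt (sub_lt_self t hδ) htc)
    have hqδ := (le_max_left _ _).trans_lt hq'
    have hqc := (le_max_right _ _).trans_lt hq'
    have H' : ∀ s ∈ S, s ≤ t → q ≤ s → |f s - f t - d * (s - t)| ≤ ε * |s - t| := by
      intro s hs h1 h2
      have := H s hs (by rw [abs_lt]; constructor <;> linarith)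
      rw [hρ, abs_sub_comm t s] at this
      rw [← abs_neg]
      convert this using 2
      ring
    refine ⟨t - q, by linarith, fun x hx hxq => ⟨by linarith, fun s hs s' hs' h1 h2 h3 h4 => ?_⟩⟩
    have h5 : q ≤ s := (h4 q hq).resolve_right (by linarith)
    exact ⟨H' s hs (by linarith) h5, H' s' hs' h1 (by linarith)⟩
  · have hlt : rho S t < t := lt_of_le_of_ne (rho_le S t) hρ
    have hρc := le_rho hc htc
    refine ⟨t - rho S t, by linarith, fun x hx hxq => ⟨by linarith,
      fun s hs s' hs' h1 h2 h3 h4 => ?_⟩⟩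
    have e1 : s' = t := by
      by_contra hne
      have := le_rho hs' (lt_of_le_of_ne h1 hne)
      linarith
    subst e1
    have e2 : rho S s' = s := by
      rw [rho, if_pos ⟨s, hs, h2.trans_lt hx⟩]
      exact IsGreatest.csSup_eq ⟨⟨hs, h2.trans_lt hx⟩, fun w hw =>
        (h4 w hw.1).resolve_right (not_le.2 hw.2)⟩
    have e3 := h.rho_eq ht
    rw [e2] at e3
    rw [e3]
    have : f s' + d * (s - s') - f s' - d * (s - s') = 0 := by ring
    rw [this]
    simp only [sub_self, mul_zero, abs_zero, le_refl, and_true]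
    positivity

/-! ### Rescaled Lagrangians -/

theorem partial2_rescale (L : ℝ → ℝ → ℝ → ℝ) (m k p q t x v : ℝ) :
    partial2 (fun t x v => k * L (m * t) (p * x) (q * v)) t x v =
      k * (p * partial2 L (m * t) (p * x) (q * v)) := by
  simp only [partial2]
  rw [deriv_const_mul_field, deriv_comp_mul_left p (fun z => L (m * t) z (q * v)), smul_eq_mul]

theorem partial3_rescale (L : ℝ → ℝ → ℝ → ℝ) (m k p q t x v : ℝ) :
    partial3 (fun t x v => k * L (m * t) (p * x) (q * v)) t x v =
      k * (q * partial3 L (m * t) (p * x) (q * v)) := by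
  simp only [partial3]
  rw [deriv_const_mul_field, deriv_comp_mul_left q (fun w => L (m * t) (p * x) w), smul_eq_mul]

/-- `k` carries the sign that turns an extremal into a minimizer, `p` and `q` carry the factors
`±u`, and `m = -1` accounts for reflection. -/
theorem IsLagrangian.rescale {T S : Set ℝ} {L : ℝ → ℝ → ℝ → ℝ} (hL : IsLagrangian T L)
    (m k p q : ℝ) (hS : ∀ t ∈ S, m * t ∈ T) :
    IsLagrangian S fun t x v => k * L (m * t) (p * x) (q * v) where
  diff2 t ht x v := ((hL.diff2 _ (hS t ht) (p * x) (q * v)).comp (f := fun z => p * z) x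
    (by fun_prop)).const_mul k
  diff3 t ht x v := ((hL.diff3 _ (hS t ht) (p * x) (q * v)).comp (f := fun z => q * z) v
    (by fun_prop)).const_mul k
  cont2 := by
    simp only [partial2_rescale]
    exact continuousOn_const.mul (continuousOn_const.mul (hL.cont2.comp
      (f := fun r : ℝ × ℝ × ℝ => (m * r.1, p * r.2.1, q * r.2.2)) (by fun_prop)
      fun r hr => ⟨hS _ hr.1, mem_univ _⟩))
  cont3 := by
    simp only [partial3_rescale]
    exact continuousOn_const.mul (continuousOn_const.mul (hL.cont3.comp
      (f := fun r : ℝ × ℝ × ℝ => (m * r.1, p * r.2.1, q * r.2.2)) (by fun_prop)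
      fun r hr => ⟨hS _ hr.1, mem_univ _⟩))

/-- `y` is an extremal: it minimizes the `k`-fold of the cost. -/
def IsExtremal (T : Set ℝ) (u a b α β : ℝ) (L : ℝ → ℝ → ℝ → ℝ) (k : ℝ) (y : ℝ → ℝ) : Prop :=
  IsAdmissible T u a b α β y ∧ ∃ J, HasCost T u a b L y J ∧
    ∀ z J', IsAdmissible T u a b α β z → HasCost T u a b L z J' → k * J ≤ k * J'

theorem exists_isExtremal {T : Set ℝ} {u a b α β : ℝ} {L : ℝ → ℝ → ℝ → ℝ} {y : ℝ → ℝ}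
    (hy : IsMinimizer T u a b α β L y ∨ IsMaximizer T u a b α β L y) :
    ∃ k : ℝ, k * k = 1 ∧ IsExtremal T u a b α β L k y := by
  rcases hy with ⟨h, J, hJ, H⟩ | ⟨h, J, hJ, H⟩
  · exact ⟨1, by norm_num, h, J, hJ, fun z J' hz hJ' => by simpa using H z J' hz hJ'⟩
  · exact ⟨-1, by norm_num, h, J, hJ, fun z J' hz hJ' => by simpa using H z J' hz hJ'⟩

theorem regulated_of_continuousOn {T : Set ℝ} {f : ℝ → ℝ} (hf : ContinuousOn f T) :
    Regulated T f := fun t ht =>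
  ⟨fun _ => ⟨f t, (hf t ht).mono_left (nhdsWithin_mono t inter_subset_left)⟩,
   fun _ => ⟨f t, (hf t ht).mono_left (nhdsWithin_mono t inter_subset_left)⟩⟩

/-! ### The case `u > 0` -/

section Pos

variable {T : Set ℝ} {u a b : ℝ}

theorem directed_of_pos (hb : IsGreatest T b) (hu : 0 < u) : directed T u = T ∩ Iio b := by
  ext t
  constructor
  · rintro ⟨ht, h, -⟩
    obtain ⟨s, hs, hts⟩ := h hu
    exact ⟨ht, hts.trans_le (hb.2 hs)⟩
  · rintro ⟨ht, h⟩
    exact ⟨ht, fun _ => ⟨b, hb.1, h⟩, fun h => absurd h (not_lt.2 hu.le)⟩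

theorem epiderivExtend_of_pos (hT : IsClosed T) (hb : IsGreatest T b) (hu : 0 < u)
    {y y' : ℝ → ℝ} (hy : ∀ t ∈ upperKappa T, HasDeltaDeriv T y (y' t) t) {t : ℝ} (ht : t ∈ T)
    (htb : t < b) : epiderivExtend T y t u = ((u * y' t : ℝ) : EReal) :=
  (hy t (mem_upperKappa_of_lt ht hb.1 htb)).epiderivExtend_eq ht hb.1 htb
    (hT.inter isClosed_Icc) hu

theorem along_of_pos (hT : IsClosed T) (hb : IsGreatest T b) (hu : 0 < u)
    {y y' : ℝ → ℝ} (hy : ∀ t ∈ upperKappa T, HasDeltaDeriv T y (y' t) t) (Φ : ℝ → ℝ → ℝ → ℝ)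
    {t : ℝ} (ht : t ∈ T) (htb : t < b) :
    along T u Φ y t = Φ t (u * y (sigma T t)) (u * y' t) := by
  rw [along, epiderivExtend_of_pos hT hb hu hy ht htb, EReal.toReal_coe, compXi, if_pos hu.le]

theorem HasDeltaIntegral.const_mul {f : ℝ → ℝ} {K : ℝ} (h : HasDeltaIntegral T a b f K) (c : ℝ) :
    HasDeltaIntegral T a b (fun t => c * f t) (c * K) := by
  obtain ⟨F, h1, h2, h3⟩ := h
  exact ⟨fun t => c * F t, continuousOn_const.mul h1, fun t ht => (h2 t ht).const_mul c,
    by rw [h3]; ring⟩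

theorem HasDeltaIntegral.congr {f g : ℝ → ℝ} {K : ℝ} (h : HasDeltaIntegral T a b f K)
    (hfg : ∀ t ∈ T, a ≤ t → t < b → g t = f t) : HasDeltaIntegral T a b g K := by
  obtain ⟨F, h1, h2, h3⟩ := h
  exact ⟨F, h1, fun t ht => by rw [hfg t ht.1 ht.2.1 ht.2.2]; exact h2 t ht, h3⟩

theorem isAdmissible_of_pos {α β : ℝ} (hT : IsClosed T) (hb : IsGreatest T b) (hu : 0 < u)
    {y y' : ℝ → ℝ} (hy : IsRdC1 T y y') (hya : y a = α) (hyb : y b = β) :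
    IsAdmissible T u a b α β y where
  regulated := regulated_of_continuousOn hy.continuousOn
  finite t ht := by
    rw [directed_of_pos hb hu] at ht
    rw [epiderivExtend_of_pos hT hb hu hy.deriv ht.1 ht.2]
    exact ⟨EReal.coe_ne_bot _, EReal.coe_ne_top _⟩
  left := hya
  right := hyb
  rdC1 _ := ⟨y', hy.deriv, hy.rd⟩
  ldC1 h := absurd h (not_lt.2 hu.le)

/-- Before `b` the epiderivative is `u y^Δ`, so the cost is `u` times a delta integral. Every
rd-continuously differentiable competitor with the right boundary values is admissible, and `k * k =
1` allows passage between the integrals of `L` and of `k L`. -/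
theorem IsExtremal.isDeltaMinimizer {α β k : ℝ} {L : ℝ → ℝ → ℝ → ℝ} {y : ℝ → ℝ}
    (hT : IsClosed T) (hb : IsGreatest T b) (hu : 0 < u) (hk : k * k = 1)
    (h : IsExtremal T u a b α β L k y) :
    ∃ y', IsDeltaMinimizer T a b (fun t x v => k * L (1 * t) (u * x) (u * v)) y y' := by
  obtain ⟨hA, J, ⟨K, hK, -, rfl⟩, hmin⟩ := h
  obtain ⟨y', hd, hr⟩ := hA.rdC1 hu
  refine ⟨y', ⟨hd, hr⟩, k * K, ((hK hu.le).const_mul k).congr fun t ht _ htb => ?_,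
    fun z z' J' hz hza hzb hJ' => ?_⟩
  · rw [along_of_pos hT hb hu hd L ht htb, one_mul]
  · have h1 : HasCost T u a b L z (u * (k * J')) :=
      ⟨k * J', fun _ => (hJ'.const_mul k).congr fun t ht _ htb => by
        rw [along_of_pos hT hb hu hz.deriv L ht htb, one_mul, ← mul_assoc, hk, one_mul],
        fun h => absurd h (not_lt.2 hu.le), rfl⟩
    have h2 := hmin z _ (isAdmissible_of_pos hT hb hu hz (hza.trans hA.left)
      (hzb.trans hA.right)) h1
    have h3 : k * (u * (k * J')) = u * J' := by linear_combination u * J' * hk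
    rw [h3, mul_left_comm] at h2
    exact le_of_mul_le_mul_left h2 hu

theorem IsExtremal.exists_delta_antideriv {α β k : ℝ} {L : ℝ → ℝ → ℝ → ℝ} {y : ℝ → ℝ}
    (hT : IsClosed T) (ha : IsLeast T a) (hb : IsGreatest T b) (hab : a < b) (hu : 0 < u)
    (hL : IsLagrangian T L) (hk : k * k = 1) (h : IsExtremal T u a b α β L k y) :
    ∃ y' P : ℝ → ℝ, (∀ t ∈ upperKappa T, HasDeltaDeriv T y (y' t) t) ∧
      (∀ t ∈ upperKappa T, partial3 L t (u * y (sigma T t)) (u * y' t) = P t) ∧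
      ∀ t ∈ upperKappa T,
        HasDeltaDeriv T P (partial2 L t (u * y (sigma T t)) (u * y' t)) t := by
  obtain ⟨y', hy⟩ := h.isDeltaMinimizer hT hb hu hk
  obtain ⟨P, h1, h2⟩ := hy.exists_antideriv hT ha hb hab
    (hL.rescale 1 k u u fun t ht => by rwa [one_mul])
  have hk0 : k ≠ 0 := fun h => by simp [h] at hk
  refine ⟨y', fun t => (k * u)⁻¹ * P t, hy.rdC1.deriv, fun t ht => ?_, fun t ht => ?_⟩
  · change _ = (k * u)⁻¹ * P t
    rw [← h1 t ht, partial3_rescale, one_mul]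
    field_simp
  · have h3 := (h2 t ht).const_mul (k * u)⁻¹
    rw [partial2_rescale, one_mul] at h3
    convert h3 using 1
    field_simp

theorem sigma_eq_of_subset {S : Set ℝ} (hS : S ⊆ T) {t c : ℝ} (hc : c ∈ S) (htc : t < c)
    (h : ∀ w ∈ T, w ≤ c → w ∈ S) : sigma S t = sigma T t := by
  have hne : (S ∩ Ioi t).Nonempty := ⟨c, hc, htc⟩
  rw [sigma, sigma, if_pos hne, if_pos ⟨c, hS hc, htc⟩]
  have hbd : ∀ A : Set ℝ, BddBelow (A ∩ Ioi t) := fun A => ⟨t, fun x hx => le_of_lt hx.2⟩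
  refine le_antisymm (le_csInf ⟨c, hS hc, htc⟩ fun w hw => ?_)
    (csInf_le_csInf (hbd T) hne (inter_subset_inter_left _ hS))
  rcases le_total w c with hwc | hwc
  · exact csInf_le (hbd S) ⟨h w hw.1 hwc, hw.2⟩
  · exact (csInf_le (hbd S) ⟨hc, htc⟩).trans hwc

/-- If the only larger point at hand is `b` itself, then `b ∈ T^κ` is left-dense and supplies points
below it. The witness `c` confines later arguments to `[t, c]`, away from `b`. -/
theorem exists_mem_between_of_not_isGreatest (hb : IsGreatest T b) {t : ℝ}
    (ht : t ∈ upperKappa T) (h : ¬ IsGreatest (upperKappa T) t) : ∃ c ∈ T, t < c ∧ c < b := by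
  have : ∃ c ∈ upperKappa T, t < c := by
    by_contra! H
    exact h ⟨ht, H⟩
  obtain ⟨c, hc, htc⟩ := this
  rcases (hb.2 hc.1).eq_or_lt with hcb | hcb
  · subst hcb
    have hρ : rho T c = c := le_antisymm (rho_le T c) (not_lt.1 fun H => hc.2 ⟨hb, H⟩)
    obtain ⟨s, hs, h1, h2⟩ := exists_mem_Ioo_of_rho_eq hρ ht.1 htc htc
    exact ⟨s, hs, h1, h2⟩
  · exact ⟨c, hc.1, htc, hcb⟩

theorem epiderivExtend_along_of_pos {L : ℝ → ℝ → ℝ → ℝ} {y y' P : ℝ → ℝ}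
    (hT : IsClosed T) (hb : IsGreatest T b) (hu : 0 < u)
    (hy : ∀ t ∈ upperKappa T, HasDeltaDeriv T y (y' t) t)
    (hP : ∀ t ∈ upperKappa T, partial3 L t (u * y (sigma T t)) (u * y' t) = P t)
    (hd : ∀ t ∈ upperKappa T,
      HasDeltaDeriv T P (partial2 L t (u * y (sigma T t)) (u * y' t)) t)
    {t : ℝ} (ht : t ∈ upperKappa T) (hmax : ¬ IsGreatest (upperKappa T) t) :
    epiderivExtend (directed T u) (along T u (partial3 L) y) t u =
      ((u * along T u (partial2 L) y t : ℝ) : EReal) := by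
  obtain ⟨c, hc, htc, hcb⟩ := exists_mem_between_of_not_isGreatest hb ht hmax
  have htb := htc.trans hcb
  rw [directed_of_pos hb hu, along_of_pos hT hb hu hy _ ht.1 htb]
  have hσ : sigma (T ∩ Iio b) t = sigma T t :=
    sigma_eq_of_subset inter_subset_left ⟨hc, hcb⟩ htc fun w hw hwc => ⟨hw, hwc.trans_lt hcb⟩
  refine (((hd t ht).mono inter_subset_left hσ).congr ?_ fun s hs => ?_).epiderivExtend_eq
    ⟨ht.1, htb⟩ ⟨hc, hcb⟩ htc ?_ hu
  · rw [hσ]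
    exact ⟨sigma_mem hT ht.1, (sigma_le hc htc).trans_lt hcb⟩
  · rw [along_of_pos hT hb hu hy _ hs.1 hs.2, hP s (mem_upperKappa_of_lt hs.1 hb.1 hs.2)]
  · have : T ∩ Iio b ∩ Icc t c = T ∩ Icc t c := by
      ext s
      exact ⟨fun h => ⟨h.1.1, h.2⟩, fun h => ⟨⟨h.1, h.2.2.trans_lt hcb⟩, h.2⟩⟩
    rw [this]
    exact hT.inter isClosed_Icc

/-- The derivative passes to `T^κ` because `T` and `T^κ` have the same `σ` at `t`. This fails
exactly at a maximum of `T^κ` other than `b`, whose successor `b` has been removed. -/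
theorem hasDeltaDeriv_upperKappa {G P : ℝ → ℝ} {d t : ℝ} (hT : IsClosed T)
    (hb : IsGreatest T b) (hd : HasDeltaDeriv T P d t) (hG : ∀ s ∈ upperKappa T, G s = P s)
    (ht : t ∈ upperKappa T) (hmax : IsGreatest (upperKappa T) t → t = b) :
    HasDeltaDeriv (upperKappa T) G d t := by
  have key : sigma (upperKappa T) t = sigma T t ∧ sigma T t ∈ upperKappa T := by
    by_cases h : IsGreatest (upperKappa T) t
    · have htb := hmax h
      have h2 : sigma T t = t := by rw [htb]; exact sigma_of_isGreatest hb
      rw [sigma_of_isGreatest h, h2]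
      exact ⟨rfl, ht⟩
    · obtain ⟨c, hc, htc, hcb⟩ := exists_mem_between_of_not_isGreatest hb ht h
      exact ⟨sigma_eq_of_subset (upperKappa_subset T) (mem_upperKappa_of_lt hc hb.1 hcb) htc
        fun w hw hwc => mem_upperKappa_of_lt hw hb.1 (hwc.trans_lt hcb),
        mem_upperKappa_of_lt (sigma_mem hT ht.1) hb.1 ((sigma_le hc htc).trans_lt hcb)⟩
  exact (hd.mono (upperKappa_subset T) key.1).congr (key.1 ▸ key.2) hG

end Pos

/-! ### Reflection -/

section Reflection

variable {T : Set ℝ} {u a b : ℝ}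

theorem sigma_reflect (T : Set ℝ) (t : ℝ) : sigma (Neg.neg ⁻¹' T) t = -rho T (-t) := by
  have h : Neg.neg ⁻¹' T ∩ Ioi t = Neg.neg ⁻¹' (T ∩ Iio (-t)) := by
    ext s; simp
  have hne : (Neg.neg ⁻¹' T ∩ Ioi t).Nonempty ↔ (T ∩ Iio (-t)).Nonempty := by
    rw [h]
    exact ⟨fun ⟨s, hs⟩ => ⟨-s, hs⟩, fun ⟨s, hs⟩ => ⟨-s, by rwa [mem_preimage, neg_neg]⟩⟩
  unfold sigma rho
  by_cases hc : (T ∩ Iio (-t)).Nonempty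
  · rw [if_pos hc, if_pos (hne.2 hc), h, Real.sInf_def]
    congr 2
    ext s
    simp
  · rw [if_neg hc, if_neg (fun h => hc (hne.1 h)), neg_neg]

theorem reflect_reflect (T : Set ℝ) : Neg.neg ⁻¹' (Neg.neg ⁻¹' T) = T := by
  ext s; simp

theorem rho_reflect (T : Set ℝ) (t : ℝ) : rho (Neg.neg ⁻¹' T) t = -sigma T (-t) := by
  have := sigma_reflect (Neg.neg ⁻¹' T) (-t)
  rw [reflect_reflect, neg_neg] at this
  rw [this, neg_neg]

theorem isLeast_reflect (hb : IsGreatest T b) : IsLeast (Neg.neg ⁻¹' T) (-b) :=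
  ⟨by rw [mem_preimage, neg_neg]; exact hb.1, fun _ hs => neg_le.1 (hb.2 hs)⟩

theorem isGreatest_reflect (ha : IsLeast T a) : IsGreatest (Neg.neg ⁻¹' T) (-a) :=
  ⟨by rw [mem_preimage, neg_neg]; exact ha.1, fun _ hs => le_neg.1 (ha.2 hs)⟩

theorem upperKappa_reflect (T : Set ℝ) :
    upperKappa (Neg.neg ⁻¹' T) = Neg.neg ⁻¹' lowerKappa T := by
  ext t
  have h1 : IsGreatest (Neg.neg ⁻¹' T) t ↔ IsLeast T (-t) := by
    refine ⟨fun h => ?_, fun h => ?_⟩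
    · have := isLeast_reflect h
      rwa [reflect_reflect] at this
    · have := isGreatest_reflect h
      rwa [neg_neg] at this
  have h2 : rho (Neg.neg ⁻¹' T) t < t ↔ -t < sigma T (-t) := by
    rw [rho_reflect, neg_lt]
  simp only [upperKappa, lowerKappa, mem_ofPred_eq, mem_preimage, h1, h2]

theorem hasDeltaDeriv_reflect {f : ℝ → ℝ} {d t : ℝ} :
    HasDeltaDeriv (Neg.neg ⁻¹' T) (fun s => f (-s)) (-d) (-t) ↔ HasNablaDeriv T f d t := by
  unfold HasDeltaDeriv HasNablaDeriv
  rw [sigma_reflect, neg_neg]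
  simp only [neg_neg]
  refine forall₂_congr fun ε hε => exists_congr fun δ => and_congr_right fun _ => ?_
  have e0 : ∀ p q : ℝ, |-p - -q| = |p - q| := fun p q => by
    rw [neg_sub_neg, abs_sub_comm]
  refine ⟨fun h s hs hst => ?_, fun h s hs hst => ?_⟩
  · have h1 := h (-s) (by rwa [mem_preimage, neg_neg]) (by rwa [e0])
    rw [neg_neg, e0, neg_sub_neg] at h1
    convert h1 using 2
    ring
  · have h1 := h (-s) hs (by rw [← e0, neg_neg]; exact hst)
    rw [← e0 (rho T t), neg_neg] at h1
    convert h1 using 2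
    ring

theorem tendsto_neg_nhdsWithin (A : Set ℝ) (t : ℝ) :
    Tendsto (fun s : ℝ => -s) (𝓝[Neg.neg ⁻¹' A] t) (𝓝[A] (-t)) :=
  tendsto_nhdsWithin_iff.2 ⟨continuous_neg.continuousAt.tendsto.mono_left nhdsWithin_le_nhds,
    eventually_nhdsWithin_of_forall fun _ hs => hs⟩

theorem LdContinuousOn.reflect {S : Set ℝ} {f : ℝ → ℝ} (hf : LdContinuousOn T S f) :
    RdContinuousOn (Neg.neg ⁻¹' T) (Neg.neg ⁻¹' S) fun s => f (-s) := by
  intro t ht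
  constructor
  · intro h
    rw [sigma_reflect, neg_eq_iff_eq_neg] at h
    exact ((hf (-t) ht).1 h).tendsto.comp (tendsto_neg_nhdsWithin S t)
  · intro h
    rw [rho_reflect, neg_eq_iff_eq_neg] at h
    obtain ⟨l, hl⟩ := (hf (-t) ht).2 h
    have e : Neg.neg ⁻¹' S ∩ Iio t = Neg.neg ⁻¹' (S ∩ Ioi (-t)) := by ext s; simp
    rw [e]
    exact ⟨l, hl.comp (tendsto_neg_nhdsWithin _ t)⟩

theorem RdContinuousOn.reflect {S : Set ℝ} {f : ℝ → ℝ}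
    (hf : RdContinuousOn (Neg.neg ⁻¹' T) (Neg.neg ⁻¹' S) f) :
    LdContinuousOn T S fun s => f (-s) := by
  intro t ht
  have ht' : -t ∈ Neg.neg ⁻¹' S := by rwa [mem_preimage, neg_neg]
  constructor
  · intro h
    have h1 := ((hf (-t) ht').1 (by rw [sigma_reflect, neg_neg, h])).tendsto.comp
      (tendsto_neg_nhdsWithin _ t)
    rwa [reflect_reflect] at h1
  · intro h
    obtain ⟨l, hl⟩ := (hf (-t) ht').2 (by rw [rho_reflect, neg_neg, h])
    have e : S ∩ Ioi t = Neg.neg ⁻¹' (Neg.neg ⁻¹' S ∩ Iio (-t)) := by ext s; simp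
    rw [e]
    exact ⟨l, hl.comp (tendsto_neg_nhdsWithin _ t)⟩

theorem HasNablaDeriv.congr {f g : ℝ → ℝ} {d t : ℝ} (hT : rho T t ∈ T)
    (hf : HasNablaDeriv T f d t) (h : ∀ s ∈ T, g s = f s) : HasNablaDeriv T g d t := by
  intro ε hε
  obtain ⟨δ, hδ, H⟩ := hf ε hε
  refine ⟨δ, hδ, fun s hs hst => ?_⟩
  rw [h _ hT, h s hs]
  exact H s hs hst

theorem HasNablaDeriv.mono {S : Set ℝ} {f : ℝ → ℝ} {d t : ℝ}
    (hf : HasNablaDeriv T f d t) (hS : S ⊆ T) (h : rho S t = rho T t) :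
    HasNablaDeriv S f d t := by
  intro ε hε
  obtain ⟨δ, hδ, H⟩ := hf ε hε
  exact ⟨δ, hδ, fun s hs hst => by rw [h]; exact H s (hS hs) hst⟩

theorem eq_of_hasNablaDeriv (ha : IsLeast T a) (hb : IsGreatest T b) (hab : a < b)
    {f : ℝ → ℝ} {d e t : ℝ} (ht : t ∈ lowerKappa T) (hd : HasNablaDeriv T f d t)
    (he : HasNablaDeriv T f e t) : d = e :=
  neg_injective (eq_of_hasDeltaDeriv (isLeast_reflect hb) (isGreatest_reflect ha)
    (neg_lt_neg hab) (by rw [upperKappa_reflect, mem_preimage, neg_neg]; exact ht)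
    (hasDeltaDeriv_reflect.2 hd) (hasDeltaDeriv_reflect.2 he))

theorem rho_mem (hT : IsClosed T) {t : ℝ} (ht : t ∈ T) : rho T t ∈ T := by
  have := sigma_mem (hT.preimage continuous_neg) (t := -t) (by rwa [mem_preimage, neg_neg])
  rwa [sigma_reflect, neg_neg, mem_preimage, neg_neg] at this

theorem mem_lowerKappa_of_lt {s t : ℝ} (ht : t ∈ T) (hs : s ∈ T) (h : s < t) :
    t ∈ lowerKappa T := ⟨ht, fun H => absurd (H.1.2 hs) (not_le.2 h)⟩

/-! ### The case `u < 0` -/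

theorem directed_of_neg (ha : IsLeast T a) (hu : u < 0) : directed T u = T ∩ Ioi a := by
  ext t
  constructor
  · rintro ⟨ht, -, h⟩
    obtain ⟨s, hs, hts⟩ := h hu
    exact ⟨ht, (ha.2 hs).trans_lt hts⟩
  · rintro ⟨ht, h⟩
    exact ⟨ht, fun h => absurd h (not_lt.2 hu.le), fun _ => ⟨a, ha.1, h⟩⟩

theorem epiderivExtend_of_neg (hT : IsClosed T) (ha : IsLeast T a) (hu : u < 0)
    {y y' : ℝ → ℝ} (hy : ∀ t ∈ lowerKappa T, HasNablaDeriv T y (y' t) t) {t : ℝ} (ht : t ∈ T)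
    (hat : a < t) : epiderivExtend T y t u = ((u * y' t : ℝ) : EReal) :=
  (hy t (mem_lowerKappa_of_lt ht ha.1 hat)).epiderivExtend_eq ht ha.1 hat
    (hT.inter isClosed_Icc) hu

theorem along_of_neg (hT : IsClosed T) (ha : IsLeast T a) (hu : u < 0)
    {y y' : ℝ → ℝ} (hy : ∀ t ∈ lowerKappa T, HasNablaDeriv T y (y' t) t) (Φ : ℝ → ℝ → ℝ → ℝ)
    {t : ℝ} (ht : t ∈ T) (hat : a < t) :
    along T u Φ y t = Φ t (u * y (rho T t)) (u * y' t) := by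
  rw [along, epiderivExtend_of_neg hT ha hu hy ht hat, EReal.toReal_coe, compXi,
    if_neg (not_le.2 hu)]

/-- Reflection reverses the sign of the derivative and exchanges the end points; the antiderivative
`-F(-t)` undoes both changes. -/
theorem HasNablaIntegral.reflect {f : ℝ → ℝ} {K : ℝ} (h : HasNablaIntegral T a b f K) :
    HasDeltaIntegral (Neg.neg ⁻¹' T) (-b) (-a) (fun t => f (-t)) K := by
  obtain ⟨F, h1, h2, h3⟩ := h
  refine ⟨fun t => (-1) * F (-t), continuousOn_const.mul (h1.comp continuous_neg.continuousOn
    fun s hs => ⟨hs.1, le_neg.1 hs.2.2, neg_le.1 hs.2.1⟩), fun t ht => ?_, by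
    simp only [neg_neg, h3]; ring⟩
  have h4 := (hasDeltaDeriv_reflect.2 (h2 (-t) ⟨ht.1, lt_neg.1 ht.2.2, neg_le.1 ht.2.1⟩)).const_mul
    (-1)
  rwa [neg_mul_neg, one_mul, neg_neg] at h4

theorem HasDeltaIntegral.reflect {f : ℝ → ℝ} {K : ℝ}
    (h : HasDeltaIntegral (Neg.neg ⁻¹' T) (-b) (-a) f K) :
    HasNablaIntegral T a b (fun t => f (-t)) K := by
  obtain ⟨F, h1, h2, h3⟩ := h
  refine ⟨fun t => (-1) * F (-t), continuousOn_const.mul (h1.comp continuous_neg.continuousOn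
    fun s hs => ⟨by rw [mem_preimage, neg_neg]; exact hs.1, neg_le_neg hs.2.2,
      neg_le_neg hs.2.1⟩), fun t ht => ?_, by rw [h3]; ring⟩
  have h4 := (h2 (-t) ⟨by rw [mem_preimage, neg_neg]; exact ht.1, neg_le_neg ht.2.2,
    neg_lt_neg ht.2.1⟩).const_mul (-1)
  rw [← hasDeltaDeriv_reflect]
  simpa using h4

theorem HasNablaIntegral.congr {f g : ℝ → ℝ} {K : ℝ} (h : HasNablaIntegral T a b f K)
    (hfg : ∀ t ∈ T, a < t → t ≤ b → g t = f t) : HasNablaIntegral T a b g K := by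
  obtain ⟨F, h1, h2, h3⟩ := h
  exact ⟨F, h1, fun t ht => by rw [hfg t ht.1 ht.2.1 ht.2.2]; exact h2 t ht, h3⟩

theorem IsRdC1.hasNablaDeriv {z z' : ℝ → ℝ} (hz : IsRdC1 (Neg.neg ⁻¹' T) z z') :
    ∀ t ∈ lowerKappa T, HasNablaDeriv T (fun s => z (-s)) (-z' (-t)) t := by
  intro t ht
  have := hz.deriv (-t) (by rw [upperKappa_reflect, mem_preimage, neg_neg]; exact ht)
  rw [← hasDeltaDeriv_reflect]
  simpa using this

theorem ldContinuousOn_neg {S : Set ℝ} {f : ℝ → ℝ} (hf : LdContinuousOn T S f) :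
    LdContinuousOn T S fun t => -f t := fun t ht =>
  ⟨fun h => ((hf t ht).1 h).neg, fun h => ((hf t ht).2 h).imp' Neg.neg fun _ hl => hl.neg⟩

theorem isAdmissible_of_neg {α β : ℝ} (hT : IsClosed T) (ha : IsLeast T a) (hu : u < 0)
    {z z' : ℝ → ℝ} (hz : IsRdC1 (Neg.neg ⁻¹' T) z z') (hza : z (-a) = α) (hzb : z (-b) = β) :
    IsAdmissible T u a b α β fun s => z (-s) where
  regulated := regulated_of_continuousOn (hz.continuousOn.comp continuous_neg.continuousOn
    fun s hs => by rwa [mem_preimage, neg_neg])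
  finite t ht := by
    rw [directed_of_neg ha hu] at ht
    rw [epiderivExtend_of_neg hT ha hu hz.hasNablaDeriv ht.1 ht.2]
    exact ⟨EReal.coe_ne_bot _, EReal.coe_ne_top _⟩
  left := hza
  right := hzb
  rdC1 h := absurd h (not_lt.2 hu.le)
  ldC1 _ := ⟨fun t => -z' (-t), hz.hasNablaDeriv, by
    have := hz.rd
    rw [upperKappa_reflect] at this
    exact ldContinuousOn_neg this.reflect⟩

/-- The reflected function has derivative `-y'(-s)`, whence the factor `-u` in the last argument. As
`u < 0`, writing `k u K` as `(-u) ((-k) K)` shows that `-k` is the sign that makes it a minimizer.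
-/
theorem IsExtremal.isDeltaMinimizer_reflect {α β k : ℝ} {L : ℝ → ℝ → ℝ → ℝ} {y : ℝ → ℝ}
    (hT : IsClosed T) (ha : IsLeast T a) (hu : u < 0) (hk : k * k = 1)
    (h : IsExtremal T u a b α β L k y) :
    ∃ y' : ℝ → ℝ, (∀ t ∈ lowerKappa T, HasNablaDeriv T y (y' t) t) ∧
      IsDeltaMinimizer (Neg.neg ⁻¹' T) (-b) (-a)
        (fun t x v => (-k) * L ((-1) * t) (u * x) ((-u) * v)) (fun s => y (-s))
        fun s => -y' (-s) := by
  obtain ⟨hA, J, ⟨K, -, hK, rfl⟩, hmin⟩ := h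
  obtain ⟨y', hd, hr⟩ := hA.ldC1 hu
  refine ⟨y', hd, ⟨fun t ht => ?_, ?_⟩, (-k) * K,
    ((hK hu).reflect.const_mul (-k)).congr fun t ht _ hta => ?_,
    fun z z' J' hz hzb hza hJ' => ?_⟩
  · rw [upperKappa_reflect] at ht
    have := hasDeltaDeriv_reflect.2 (hd (-t) ht)
    rwa [neg_neg] at this
  · rw [upperKappa_reflect]
    exact (ldContinuousOn_neg hr).reflect
  · rw [along_of_neg hT ha hu hd L ht (lt_neg.1 hta), sigma_reflect, neg_mul_neg, neg_one_mul,
      neg_neg]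
  · rw [neg_neg] at hza hzb
    have h1 : HasCost T u a b L (fun s => z (-s)) (u * ((-k) * J')) :=
      ⟨(-k) * J', fun h => absurd h (not_le.2 hu), fun _ =>
        (hJ'.const_mul (-k)).reflect.congr fun t ht hat _ => by
          rw [along_of_neg hT ha hu hz.hasNablaDeriv L ht hat, sigma_reflect, neg_neg,
            neg_one_mul, neg_neg, ← mul_assoc, neg_mul_neg, hk, one_mul, neg_mul_comm], rfl⟩
    have h2 := hmin _ _ (isAdmissible_of_neg hT ha hu hz (hza.trans hA.left)
      (hzb.trans hA.right)) h1
    have h3 : k * (u * ((-k) * J')) = (-u) * J' := by linear_combination (-u) * J' * hk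
    have h4 : k * (u * K) = (-u) * ((-k) * K) := by ring
    rw [h3, h4] at h2
    exact le_of_mul_le_mul_left h2 (neg_pos.2 hu)

theorem IsExtremal.exists_nabla_antideriv {α β k : ℝ} {L : ℝ → ℝ → ℝ → ℝ} {y : ℝ → ℝ}
    (hT : IsClosed T) (ha : IsLeast T a) (hb : IsGreatest T b) (hab : a < b) (hu : u < 0)
    (hL : IsLagrangian T L) (hk : k * k = 1) (h : IsExtremal T u a b α β L k y) :
    ∃ y' P : ℝ → ℝ, (∀ t ∈ lowerKappa T, HasNablaDeriv T y (y' t) t) ∧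
      (∀ t ∈ lowerKappa T, partial3 L t (u * y (rho T t)) (u * y' t) = P t) ∧
      ∀ t ∈ lowerKappa T,
        HasNablaDeriv T P (partial2 L t (u * y (rho T t)) (u * y' t)) t := by
  obtain ⟨y', hd, hy⟩ := h.isDeltaMinimizer_reflect hT ha hu hk
  obtain ⟨P, h1, h2⟩ := hy.exists_antideriv (hT.preimage continuous_neg) (isLeast_reflect hb)
    (isGreatest_reflect ha) (neg_lt_neg hab)
    (hL.rescale (-1) (-k) u (-u) fun t ht => by rwa [neg_one_mul])
  have hk0 : k ≠ 0 := fun h => by simp [h] at hk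
  have hu0 : u ≠ 0 := hu.ne
  have hmem : ∀ t ∈ lowerKappa T, -t ∈ upperKappa (Neg.neg ⁻¹' T) := fun t ht => by
    rw [upperKappa_reflect, mem_preimage, neg_neg]; exact ht
  refine ⟨y', fun t => (k * u)⁻¹ * P (-t), hd, fun t ht => ?_, fun t ht => ?_⟩
  · change _ = (k * u)⁻¹ * P (-t)
    rw [← h1 _ (hmem t ht), partial3_rescale, sigma_reflect]
    simp only [neg_neg, neg_mul_neg, one_mul]
    field_simp
  · have h3 := (h2 _ (hmem t ht)).const_mul (k * u)⁻¹
    rw [partial2_rescale, sigma_reflect] at h3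
    simp only [neg_neg, neg_mul_neg, one_mul] at h3
    rw [← hasDeltaDeriv_reflect]
    simp only [neg_neg]
    convert h3 using 1
    field_simp

theorem rho_eq_of_subset {S : Set ℝ} (hS : S ⊆ T) {t c : ℝ} (hc : c ∈ S) (hct : c < t)
    (h : ∀ w ∈ T, c ≤ w → w ∈ S) : rho S t = rho T t := by
  have := sigma_eq_of_subset (S := Neg.neg ⁻¹' S) (T := Neg.neg ⁻¹' T) (t := -t) (c := -c)
    (preimage_mono hS) (by rwa [mem_preimage, neg_neg]) (neg_lt_neg hct)
    fun w hw hwc => h _ hw (le_neg.1 hwc)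
  rw [sigma_reflect, sigma_reflect, neg_neg] at this
  exact neg_injective this

theorem rho_of_isLeast (ha : IsLeast T a) : rho T a = a := by
  have := sigma_of_isGreatest (isGreatest_reflect ha)
  rw [sigma_reflect, neg_neg] at this
  exact neg_injective this

theorem exists_mem_between_of_not_isLeast (ha : IsLeast T a) {t : ℝ}
    (ht : t ∈ lowerKappa T) (h : ¬ IsLeast (lowerKappa T) t) : ∃ c ∈ T, a < c ∧ c < t := by
  have : ∃ c ∈ lowerKappa T, c < t := by
    by_contra! H
    exact h ⟨ht, H⟩
  obtain ⟨c, hc, hct⟩ := this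
  rcases (ha.2 hc.1).eq_or_lt with hac | hac
  · subst hac
    have hσ : sigma T a = a := le_antisymm (not_lt.1 fun H => hc.2 ⟨ha, H⟩) (le_sigma T a)
    obtain ⟨s, hs, h1, h2⟩ := exists_mem_Ioo_of_sigma_eq hσ ht.1 hct hct
    exact ⟨s, hs, h1, h2⟩
  · exact ⟨c, hc.1, hac, hct⟩

theorem epiderivExtend_along_of_neg {L : ℝ → ℝ → ℝ → ℝ} {y y' P : ℝ → ℝ}
    (hT : IsClosed T) (ha : IsLeast T a) (hu : u < 0)
    (hy : ∀ t ∈ lowerKappa T, HasNablaDeriv T y (y' t) t)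
    (hP : ∀ t ∈ lowerKappa T, partial3 L t (u * y (rho T t)) (u * y' t) = P t)
    (hd : ∀ t ∈ lowerKappa T,
      HasNablaDeriv T P (partial2 L t (u * y (rho T t)) (u * y' t)) t)
    {t : ℝ} (ht : t ∈ lowerKappa T) (hmin : ¬ IsLeast (lowerKappa T) t) :
    epiderivExtend (directed T u) (along T u (partial3 L) y) t u =
      ((u * along T u (partial2 L) y t : ℝ) : EReal) := by
  obtain ⟨c, hc, hac, hct⟩ := exists_mem_between_of_not_isLeast ha ht hmin
  have hat := hac.trans hct
  rw [directed_of_neg ha hu, along_of_neg hT ha hu hy _ ht.1 hat]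
  have hρ : rho (T ∩ Ioi a) t = rho T t :=
    rho_eq_of_subset inter_subset_left ⟨hc, hac⟩ hct fun w hw hwc => ⟨hw, hac.trans_le hwc⟩
  refine (((hd t ht).mono inter_subset_left hρ).congr ?_ fun s hs => ?_).epiderivExtend_eq
    ⟨ht.1, hat⟩ ⟨hc, hac⟩ hct ?_ hu
  · rw [hρ]
    exact ⟨rho_mem hT ht.1, hac.trans_le (le_rho hc hct)⟩
  · rw [along_of_neg hT ha hu hy _ hs.1 hs.2, hP s (mem_lowerKappa_of_lt hs.1 ha.1 hs.2)]
  · have : T ∩ Ioi a ∩ Icc c t = T ∩ Icc c t := by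
      ext s
      exact ⟨fun h => ⟨h.1.1, h.2⟩, fun h => ⟨⟨h.1, hac.trans_le h.2.1⟩, h.2⟩⟩
    rw [this]
    exact hT.inter isClosed_Icc

theorem hasNablaDeriv_lowerKappa {G P : ℝ → ℝ} {d t : ℝ} (hT : IsClosed T)
    (ha : IsLeast T a) (hd : HasNablaDeriv T P d t) (hG : ∀ s ∈ lowerKappa T, G s = P s)
    (ht : t ∈ lowerKappa T) (hmin : IsLeast (lowerKappa T) t → t = a) :
    HasNablaDeriv (lowerKappa T) G d t := by
  have key : rho (lowerKappa T) t = rho T t ∧ rho T t ∈ lowerKappa T := by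
    by_cases h : IsLeast (lowerKappa T) t
    · have hta := hmin h
      have h2 : rho T t = t := by rw [hta]; exact rho_of_isLeast ha
      rw [rho_of_isLeast h, h2]
      exact ⟨rfl, ht⟩
    · obtain ⟨c, hc, hac, hct⟩ := exists_mem_between_of_not_isLeast ha ht h
      exact ⟨rho_eq_of_subset (lowerKappa_subset T) (mem_lowerKappa_of_lt hc ha.1 hac) hct
        fun w hw hwc => mem_lowerKappa_of_lt hw ha.1 (hac.trans_le hwc),
        mem_lowerKappa_of_lt (rho_mem hT ht.1) ha.1 (hac.trans_le (le_rho hc hct))⟩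
  exact (hd.mono (lowerKappa_subset T) key.1).congr (key.1 ▸ key.2) hG

end Reflection

/-! ### One-point time scales -/

/-- On a single point the increments of the function and of the variable both vanish, so every
number is a derivative. -/
theorem hasDeltaDeriv_of_subsingleton {S : Set ℝ} (hS : S.Subsingleton) {t : ℝ} (ht : t ∈ S)
    (f : ℝ → ℝ) (d : ℝ) : HasDeltaDeriv S f d t := by
  have h : sigma S t = t := sigma_of_isGreatest ⟨ht, fun s hs => (hS hs ht).le⟩
  refine fun ε hε => ⟨1, one_pos, fun s hs _ => ?_⟩
  rw [h, hS hs ht]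
  simp

theorem hasNablaDeriv_of_subsingleton {S : Set ℝ} (hS : S.Subsingleton) {t : ℝ} (ht : t ∈ S)
    (f : ℝ → ℝ) (d : ℝ) : HasNablaDeriv S f d t := by
  have h : rho S t = t := rho_of_isLeast ⟨ht, fun s hs => (hS ht hs).le⟩
  refine fun ε hε => ⟨1, one_pos, fun s hs _ => ?_⟩
  rw [h, hS hs ht]
  simp

end TimeScale

/-! ### Assembly of the theorem -/

theorem mainTheorem1 (T : Set ℝ) (hT : IsClosed T) (a b : ℝ) (ha : IsLeast T a)
    (hb : IsGreatest T b) (u : ℝ) (hu : u ≠ 0) (α β : ℝ) (L : ℝ → ℝ → ℝ → ℝ)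
    (hL : TimeScale.IsLagrangian T L) (y : ℝ → ℝ)
    (hy : TimeScale.IsMinimizer T u a b α β L y ∨ TimeScale.IsMaximizer T u a b α β L y) :
    -- the unified Euler–Lagrange equation
    (∀ t ∈ TimeScale.upperKappa (TimeScale.upperKappa T) ∩
        TimeScale.lowerKappa (TimeScale.lowerKappa T),
      (0 < u → ¬ IsGreatest (TimeScale.upperKappa T) t) →
      (u < 0 → ¬ IsLeast (TimeScale.lowerKappa T) t) →
      TimeScale.epiderivExtend (TimeScale.directed T u)
          (TimeScale.along T u (TimeScale.partial3 L) y) t u =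
        ((u * TimeScale.along T u (TimeScale.partial2 L) y t : ℝ) : EReal)) ∧
    -- its delta form for `u > 0`
    (0 < u → ∀ y' : ℝ → ℝ,
      (∀ t ∈ TimeScale.upperKappa T, TimeScale.HasDeltaDeriv T y (y' t) t) →
      ∀ t ∈ TimeScale.upperKappa (TimeScale.upperKappa T) ∩
          TimeScale.lowerKappa (TimeScale.lowerKappa T),
        (IsGreatest (TimeScale.upperKappa T) t → t = b) →
        TimeScale.HasDeltaDeriv (TimeScale.upperKappa T)
          (fun s => TimeScale.partial3 L s (u * y (TimeScale.sigma T s)) (u * y' s))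
          (TimeScale.partial2 L t (u * y (TimeScale.sigma T t)) (u * y' t)) t) ∧
    -- its nabla form for `u < 0`
    (u < 0 → ∀ y' : ℝ → ℝ,
      (∀ t ∈ TimeScale.lowerKappa T, TimeScale.HasNablaDeriv T y (y' t) t) →
      ∀ t ∈ TimeScale.upperKappa (TimeScale.upperKappa T) ∩
          TimeScale.lowerKappa (TimeScale.lowerKappa T),
        (IsLeast (TimeScale.lowerKappa T) t → t = a) →
        TimeScale.HasNablaDeriv (TimeScale.lowerKappa T)
          (fun s => TimeScale.partial3 L s (u * y (TimeScale.rho T s)) (u * y' s))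
          (TimeScale.partial2 L t (u * y (TimeScale.rho T t)) (u * y' t)) t) := by
  rcases (ha.2 hb.1).eq_or_lt with hab | hab
  · have hsub : T.Subsingleton := fun s hs t ht => by
      have h1 := ha.2 hs
      have h2 := hb.2 hs
      have h3 := ha.2 ht
      have h4 := hb.2 ht
      linarith
    have hsubU := hsub.anti (TimeScale.upperKappa_subset T)
    have hsubL := hsub.anti (TimeScale.lowerKappa_subset T)
    refine ⟨fun t ht hmax hmin => ?_, fun _ y' _ t ht _ => ?_, fun _ y' _ t ht _ => ?_⟩
    -- The single point is the maximum of `T^κ` and the minimum of `T_κ`, so the exclusions leave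
    -- nothing to prove.
    · rcases hu.lt_or_gt with hu' | hu'
      · exact absurd ⟨ht.2.1, fun s hs => (hsubL ht.2.1 hs).le⟩ (hmin hu')
      · exact absurd ⟨ht.1.1, fun s hs => (hsubU hs ht.1.1).le⟩ (hmax hu')
    · exact TimeScale.hasDeltaDeriv_of_subsingleton hsubU ht.1.1 _ _
    · exact TimeScale.hasNablaDeriv_of_subsingleton hsubL ht.2.1 _ _
  · obtain ⟨k, hk, hext⟩ := TimeScale.exists_isExtremal hy
    rcases hu.lt_or_gt with hu' | hu'
    · obtain ⟨y₀, P, hy₀, hP, hd⟩ := hext.exists_nabla_antideriv hT ha hb hab hu' hL hk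
      refine ⟨fun t ht _ hmin =>
        TimeScale.epiderivExtend_along_of_neg hT ha hu' hy₀ hP hd ht.2.1 (hmin hu'),
        fun h => absurd h (not_lt.2 hu'.le), fun _ y' hy' t ht hmin => ?_⟩
      -- The given derivative `y'` is arbitrary; since `a < b`, derivatives are unique and it agrees
      -- with the one produced by the extremality argument.
      have heq : ∀ s ∈ TimeScale.lowerKappa T, y' s = y₀ s := fun s hs =>
        TimeScale.eq_of_hasNablaDeriv ha hb hab hs (hy' s hs) (hy₀ s hs)
      rw [heq t ht.2.1]
      exact TimeScale.hasNablaDeriv_lowerKappa hT ha (hd t ht.2.1)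
        (fun s hs => by rw [heq s hs, hP s hs]) ht.2.1 hmin
    · obtain ⟨y₀, P, hy₀, hP, hd⟩ := hext.exists_delta_antideriv hT ha hb hab hu' hL hk
      refine ⟨fun t ht hmax _ =>
        TimeScale.epiderivExtend_along_of_pos hT hb hu' hy₀ hP hd ht.1.1 (hmax hu'),
        fun _ y' hy' t ht hmax => ?_, fun h => absurd h (not_lt.2 hu'.le)⟩
      have heq : ∀ s ∈ TimeScale.upperKappa T, y' s = y₀ s := fun s hs =>
        TimeScale.eq_of_hasDeltaDeriv ha hb hab hs (hy' s hs) (hy₀ s hs)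
      rw [heq t ht.1.1]
      exact TimeScale.hasDeltaDeriv_upperKappa hT hb (hd t ht.1.1)
        (fun s hs => by rw [heq s hs, hP s hs]) ht.1.1 hmax
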